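/- Let $\mathbf A=(A(1),\dots,A(\nu))$ be a random sequence of positive real numbers of random finite length $\nu\in\{0,1,2,\dots\}$, and let $(\mathbf A_x)$ be i.i.d. copies of $\mathbf A$ indexed by the finite words $x$ on $\{1,2,\dots\}$. Let $T$ be the random weighted plane tree rooted at the empty word $\varnothing$ in which every vertex $x$ has $\nu_x$ children $x1,\dots,x\nu_x$, where $\nu_x$ is the length of $\mathbf A_x$, and the edge between $x$ and $xi$ has weight $A_x(i)$. To the edge between a vertex $x$ and its parent give the conductance $c(x)$, the product of the weights along the path from $\varnothing$ to $x$ (add an artificial parent of $\varnothing$, with $c(\varnothing)=1$). For $n\ge1$ let $C_n$ be the effective conductance of $T$ between $\varnothing$ and its $n$-th level: if $v$ is the potential on the first $n$ levels with $v(\varnothing)=0$, $v=1$ at height $n$, and $v(x)=\pi(x)^{-1}\bigl(c(x)v(x_*)+\sum_{i\le\nu_x}c(xi)v(xi)\bigr)$ at each vertex $x$ of height between $1$ and $n-1$, where $x_*$ is the parent of $x$ and $\pi(x)=c(x)+\sum_{i\le\nu_x}c(xi)$, then $C_n=\sum_{j\le\nu_\varnothing}c(j)\,(v(j)-v(\varnothing))$.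 (Thus $C_n=0$ if $T$ has no vertex at height $n$.) Let $M_n=\sum_{|x|=n}c(x)$ be the additive martingale and $M_\infty$ its almost sure limit. Put $$\psi(s)=\log \mathbf E\Bigl[\sum_{i=1}^{\nu}A(i)^s\Bigr],\qquad \kappa=\inf\{s>1:\psi(s)=0\}\in(1,\infty].$$ Assume that $\psi(1)=0$; that $\mathbf E\bigl[\sum_{i\le\nu}A(i)\log A(i)\bigr]$ exists in $[-\infty,0)$; and that $$\mathbf E\Bigl[\Bigl(\sum_{i\le\nu}A(i)\Bigr)^{\kappa}\Bigr]+\mathbf E\Bigl[\sum_{i\le\nu}A(i)^{\kappa}\log^+A(i)\Bigr]<\infty\ \text{ if } 1<\kappa\le2,\qquad \mathbf E\Bigl[\Bigl(\sum_{i\le\nu}A(i)\Bigr)^{2}\Bigr]<\infty\ \text{ if } \kappa\in(2,\infty].$$ Then: 1. if $1<\kappa<2$, then $\liminf_{n\to\infty} n^{1/(\kappa-1)}\,\mathbf E[C_n]>0$; 2. if $\kappa=2$, then $\liminf_{n\to\infty} n\log n\;\mathbf E[C_n]>0$; 3. if $\kappa>2$, then $0<\mathbf E[M_\infty^2]<\infty$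 and $\liminf_{n\to\infty} n\,\mathbf E[C_n]\ge 1/\mathbf E[M_\infty^2]$. -/

import Mathlib

open MeasureTheory ProbabilityTheory Filter Topology

namespace SubdiffusiveTree

/-- Finite (possibly empty) sequences `(a(0), …, a(ν - 1))` of positive real numbers, of arbitrary
length `ν`. This is the disjoint union over `k` of the spaces `(0, ∞)^k`, with its natural
σ-algebra. The entries are numbered from `0` instead of `1`. -/
abbrev WeightSeq : Type := Σ k : ℕ, (Fin k → Set.Ioi (0 : ℝ))

/-- The `i`-th entry of a finite sequence (with the convention `0` past its end). -/
noncomputable def WeightSeq.entry (a : WeightSeq) (i : ℕ) : ℝ :=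
  if h : i < a.1 then (a.2 ⟨i, h⟩ : ℝ) else 0

/-! ### Weighted trees -/

/-- Finite words on the alphabet `ℕ`. A word is stored with its *last* letter first: the root is
`[]`, the `i`-th child of `x` is `i :: x`, the parent of `x ≠ []` is `x.tail`, and the height of
`x` is `x.length`. -/
abbrev Word : Type := List ℕ

/-- A locally finite planar rooted weighted tree: the vertex `x` has `(t x).1` children
`0 :: x, 1 :: x, …`, and the edge between `x` and its child `i :: x` has weight `(t x).entry i`.
The sequences `t x` attached to words `x` that are not vertices of the tree play no role. -/
abbrev WeightedTree : Type := Word → WeightSeq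

/-- The vertices of the tree. -/
def IsVertex (t : WeightedTree) : Word → Prop
  | [] => True
  | i :: x => IsVertex t x ∧ i < (t x).1

/-- The vertices at height `n` (see `mem_level`). -/
def level (t : WeightedTree) : ℕ → Finset Word
  | 0 => {[]}
  | n + 1 => (level t n).biUnion fun x => (Finset.range (t x).1).image fun i => i :: x

theorem mem_level (t : WeightedTree) (n : ℕ) (x : Word) :
    x ∈ level t n ↔ IsVertex t x ∧ x.length = n := by
  induction n generalizing x with
  | zero => cases x <;> simp [level, IsVertex]
  | succ n ih =>
    cases x with
    | nil => simp [level]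
    | cons i x =>
      simp only [level, Finset.mem_biUnion, Finset.mem_image, Finset.mem_range, List.cons.injEq,
        IsVertex, List.length_cons, Nat.add_right_cancel_iff]
      constructor
      · rintro ⟨y, hy, j, hj, rfl, rfl⟩
        exact ⟨⟨((ih _).1 hy).1, hj⟩, ((ih _).1 hy).2⟩
      · rintro ⟨⟨h1, h2⟩, h3⟩
        exact ⟨x, (ih x).2 ⟨h1, h3⟩, i, h2, rfl, rfl⟩

/-- The conductance `c(x)` of the edge between `x` and its parent: the product of the weights
along the path from the root to `x`; the edge between the root and its artificial parent has
conductance `1`. -/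
noncomputable def conductance (t : WeightedTree) : Word → ℝ
  | [] => 1
  | i :: x => conductance t x * (t x).entry i

/-- `π(x)`: the sum of the conductances of the edges incident to `x`. -/
noncomputable def totalConductance (t : WeightedTree) (x : Word) : ℝ :=
  conductance t x + ∑ i ∈ Finset.range (t x).1, conductance t (i :: x)

/-- `v` is the electric potential on the first `n` levels of the tree when the root has
potential `0` and the vertices at height `n` have potential `U`. (Values of `v` outside the first
`n` levels of the tree play no role.) -/
structure IsPotential (t : WeightedTree) (n : ℕ) (U : ℝ) (v : Word → ℝ) : Prop where
  root : v [] = 0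
  top : ∀ x, IsVertex t x → x.length = n → v x = U
  harmonic : ∀ x, IsVertex t x → 1 ≤ x.length → x.length < n →
    v x = 1 / totalConductance t x * (conductance t x * v x.tail +
      ∑ i ∈ Finset.range (t x).1, conductance t (i :: x) * v (i :: x))

/-- The total current `I = ∑ c(j) (v(j) - v(root))` entering the tree, the sum being over the
children `j` of the root. -/
noncomputable def totalCurrent (t : WeightedTree) (v : Word → ℝ) : ℝ :=
  ∑ j ∈ Finset.range (t []).1, conductance t [j] * (v [j] - v [])

open Classical in
/-- The effective conductance between the root and the `n`-th level: the total current when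
the potential is `1` at height `n` and `0` at the root. For every `n ≥ 1` such a potential exists
(`exists_isPotential`) and the ratio of the current to the potential `U` at height `n` is always
`effectiveConductance t n` (`totalCurrent_eq`). It is `0` if the tree has height less than `n`. -/
noncomputable def effectiveConductance (t : WeightedTree) (n : ℕ) : ℝ :=
  if h : ∃ v, IsPotential t n 1 v then totalCurrent t h.choose else 0

theorem entry_pos (a : WeightSeq) {i : ℕ} (h : i < a.1) : 0 < a.entry i := by
  simp only [WeightSeq.entry, h, dite_true]
  exact (a.2 ⟨i, h⟩).2

theorem conductance_pos (t : WeightedTree) (x : Word) (hx : IsVertex t x) :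
    0 < conductance t x := by
  induction x with
  | nil => simp [conductance]
  | cons i x ih => exact mul_pos (ih hx.1) (entry_pos _ hx.2)

/-- Auxiliary to the well-posedness of the potential problem. -/
noncomputable def escape (t : WeightedTree) : ℕ → Word → ℝ
  | 0, _ => 1
  | m + 1, x => (∑ i ∈ Finset.range (t x).1, (t x).entry i * escape t m (i :: x)) /
      (1 + ∑ i ∈ Finset.range (t x).1, (t x).entry i * escape t m (i :: x))

theorem escape_succ (t : WeightedTree) (m : ℕ) (x : Word) : escape t (m + 1) x =
    (∑ i ∈ Finset.range (t x).1, (t x).entry i * escape t m (i :: x)) /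
      (1 + ∑ i ∈ Finset.range (t x).1, (t x).entry i * escape t m (i :: x)) := rfl

theorem escape_nonneg (t : WeightedTree) (m : ℕ) (x : Word) : 0 ≤ escape t m x := by
  induction m generalizing x with
  | zero => simp [escape]
  | succ m ih =>
    have : 0 ≤ ∑ i ∈ Finset.range (t x).1, (t x).entry i * escape t m (i :: x) :=
      Finset.sum_nonneg fun i hi =>
        mul_nonneg (entry_pos _ (Finset.mem_range.1 hi)).le (ih _)
    rw [escape_succ]
    positivity

theorem harmonic_iff (t : WeightedTree) (v : Word → ℝ) (x : Word) (hx : IsVertex t x) :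
    (v x = 1 / totalConductance t x * (conductance t x * v x.tail +
      ∑ i ∈ Finset.range (t x).1, conductance t (i :: x) * v (i :: x))) ↔
    v x - v x.tail = ∑ i ∈ Finset.range (t x).1, (t x).entry i * (v (i :: x) - v x) := by
  have hc := conductance_pos t x hx
  have hs : 0 ≤ ∑ i ∈ Finset.range (t x).1, (t x).entry i :=
    Finset.sum_nonneg fun i hi => (entry_pos _ (Finset.mem_range.1 hi)).le
  have h1 : totalConductance t x
      = conductance t x * (1 + ∑ i ∈ Finset.range (t x).1, (t x).entry i) := by
    simp only [totalConductance, conductance, ← Finset.mul_sum]; ring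
  have h2 : ∑ i ∈ Finset.range (t x).1, conductance t (i :: x) * v (i :: x)
      = conductance t x * ∑ i ∈ Finset.range (t x).1, (t x).entry i * v (i :: x) := by
    simp only [conductance, Finset.mul_sum, mul_assoc]
  have h3 : ∑ i ∈ Finset.range (t x).1, (t x).entry i * (v (i :: x) - v x)
      = ∑ i ∈ Finset.range (t x).1, (t x).entry i * v (i :: x)
        - (∑ i ∈ Finset.range (t x).1, (t x).entry i) * v x := by
    simp only [mul_sub, Finset.sum_sub_distrib, Finset.sum_mul]
  rw [h1, h2, h3, ← mul_add, one_div, mul_inv, mul_mul_mul_comm,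
    mul_comm (conductance t x)⁻¹]
  generalize (∑ i ∈ Finset.range (t x).1, (t x).entry i) = s at *
  generalize (∑ i ∈ Finset.range (t x).1, (t x).entry i * v (i :: x)) = r at *
  have : (1 + s) ≠ 0 := by positivity
  field_simp
  constructor <;> intro h <;> linarith

theorem IsPotential.sub_tail {t : WeightedTree} {n : ℕ} {U : ℝ} {v : Word → ℝ}
    (h : IsPotential t n U v) (m : ℕ) (x : Word) (hx : IsVertex t x) (h1 : 1 ≤ x.length)
    (hm : x.length + m = n) : v x - v x.tail = (U - v x.tail) * escape t m x := by
  induction m generalizing x with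
  | zero => rw [h.top x hx (by omega)]; simp [escape]
  | succ m ih =>
    have hh := (harmonic_iff t v x hx).1 (h.harmonic x hx h1 (by omega))
    have hs : 0 ≤ ∑ i ∈ Finset.range (t x).1, (t x).entry i * escape t m (i :: x) :=
      Finset.sum_nonneg fun i hi =>
        mul_nonneg (entry_pos _ (Finset.mem_range.1 hi)).le (escape_nonneg _ _ _)
    have h2 : ∑ i ∈ Finset.range (t x).1, (t x).entry i * (v (i :: x) - v x)
        = (U - v x) * ∑ i ∈ Finset.range (t x).1, (t x).entry i * escape t m (i :: x) := by
      rw [Finset.mul_sum]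
      refine Finset.sum_congr rfl fun i hi => ?_
      have := ih (i :: x) ⟨hx, Finset.mem_range.1 hi⟩ (by simp) (by simp; omega)
      simp only [List.tail_cons] at this
      rw [this]; ring
    rw [h2] at hh
    rw [escape_succ]
    generalize (∑ i ∈ Finset.range (t x).1, (t x).entry i * escape t m (i :: x)) = s at *
    have : (1 + s) ≠ 0 := by positivity
    field_simp
    linarith

/-- The potential problem has a solution. -/
theorem exists_isPotential (t : WeightedTree) (n : ℕ) (hn : 1 ≤ n) (U : ℝ) :
    ∃ v, IsPotential t n U v := by
  let v : Word → ℝ := fun x => List.rec (motive := fun _ => ℝ) 0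
    (fun i y r => r + (U - r) * escape t (n - (y.length + 1)) (i :: y)) x
  have hv : ∀ i y, v (i :: y) = v y + (U - v y) * escape t (n - (y.length + 1)) (i :: y) :=
    fun _ _ => rfl
  refine ⟨v, rfl, ?_, ?_⟩
  · intro x _ hl
    cases x with
    | nil => simp at hl; omega
    | cons i y =>
      rw [hv, show n - (y.length + 1) = 0 by simp at hl; omega]
      simp [escape]
  · intro x hx h1 hl
    rw [harmonic_iff t v x hx]
    cases x with
    | nil => simp at h1
    | cons i y =>
      obtain ⟨m, hm⟩ : ∃ m, n - (y.length + 1) = m + 1 :=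
        ⟨n - (y.length + 1) - 1, by simp at hl; omega⟩
      have h2 : ∑ j ∈ Finset.range (t (i :: y)).1,
            (t (i :: y)).entry j * (v (j :: i :: y) - v (i :: y))
          = (U - v (i :: y)) * ∑ j ∈ Finset.range (t (i :: y)).1,
            (t (i :: y)).entry j * escape t m (j :: i :: y) := by
        rw [Finset.mul_sum]
        refine Finset.sum_congr rfl fun j _ => ?_
        rw [hv j (i :: y), show n - ((i :: y).length + 1) = m by simp; omega]
        ring
      have hs : 0 ≤ ∑ j ∈ Finset.range (t (i :: y)).1,
          (t (i :: y)).entry j * escape t m (j :: i :: y) :=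
        Finset.sum_nonneg fun j hj =>
          mul_nonneg (entry_pos _ (Finset.mem_range.1 hj)).le (escape_nonneg _ _ _)
      rw [h2, List.tail_cons, hv i y, hm]
      rw [escape_succ]
      generalize (∑ j ∈ Finset.range (t (i :: y)).1,
          (t (i :: y)).entry j * escape t m (j :: i :: y)) = s at *
      have : (1 + s) ≠ 0 := by positivity
      field_simp
      ring

theorem IsPotential.totalCurrent_eq_escape {t : WeightedTree} {n : ℕ} {U : ℝ} {v : Word → ℝ}
    (h : IsPotential t n U v) (hn : 1 ≤ n) : totalCurrent t v
      = (∑ j ∈ Finset.range (t []).1, (t []).entry j * escape t (n - 1) [j]) * U := by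
  unfold totalCurrent
  rw [Finset.sum_mul]
  refine Finset.sum_congr rfl fun j hj => ?_
  have := h.sub_tail (n - 1) [j] ⟨trivial, Finset.mem_range.1 hj⟩ (by simp) (by simp; omega)
  simp only [List.tail_cons, h.root] at this
  rw [h.root, this]
  simp [conductance]; ring

/-- The current is the effective conductance times the potential difference. -/
theorem totalCurrent_eq {t : WeightedTree} {n : ℕ} (hn : 1 ≤ n) {U : ℝ} {v : Word → ℝ}
    (h : IsPotential t n U v) : totalCurrent t v = effectiveConductance t n * U := by
  have he := exists_isPotential t n hn 1
  rw [effectiveConductance, dif_pos he, he.choose_spec.totalCurrent_eq_escape hn,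
    h.totalCurrent_eq_escape hn, mul_one]

/-- The additive martingale `M_n = ∑_{|x| = n} c(x)`. -/
noncomputable def additiveMartingale (t : WeightedTree) (n : ℕ) : ℝ :=
  ∑ x ∈ level t n, conductance t x

/-- `M_∞`, the limit of the additive martingale. -/
noncomputable def martingaleLimit (t : WeightedTree) : ℝ :=
  limUnder atTop (additiveMartingale t)

/-! ### The law of the weights -/

/-- The characteristic function `ψ(s) = log E[∑_{i < ν} A(i)^s] ∈ [-∞, ∞]`, where `μ` is the law
of the random sequence `A`. -/
noncomputable def psi (μ : Measure WeightSeq) (s : ℝ) : EReal :=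
  ENNReal.log (∫⁻ a, ENNReal.ofReal (∑ i ∈ Finset.range a.1, a.entry i ^ s) ∂μ)

/-- `κ = inf {s > 1 : ψ(s) = 0}`, which is `∞` if there is no such `s`. -/
noncomputable def kappa (μ : Measure WeightSeq) : EReal :=
  sInf {k : EReal | ∃ s : ℝ, 1 < s ∧ psi μ s = 0 ∧ k = (s : EReal)}

/-- `ψ(1) = 0`. -/
def HNorm (μ : Measure WeightSeq) : Prop := psi μ 1 = 0

/-- `E[∑_{i < ν} A(i) log A(i)]` exists in `[-∞, 0)`: the expectation of the positive part is
less than that of the negative part (in particular the former is finite). -/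
def HDerivative (μ : Measure WeightSeq) : Prop :=
  ∫⁻ a, ENNReal.ofReal (∑ i ∈ Finset.range a.1, a.entry i * Real.log (a.entry i)) ∂μ
    < ∫⁻ a, ENNReal.ofReal (-∑ i ∈ Finset.range a.1, a.entry i * Real.log (a.entry i)) ∂μ

/-- The integrability hypothesis: if `1 < κ ≤ 2` then
`E[(∑ A(i))^κ] + E[∑ A(i)^κ log⁺ A(i)] < ∞`, and if `κ ∈ (2, ∞]` then `E[(∑ A(i))²] < ∞`. -/
def HKappa (μ : Measure WeightSeq) : Prop :=
  (1 < kappa μ → kappa μ ≤ 2 →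
    ∫⁻ a, ENNReal.ofReal ((∑ i ∈ Finset.range a.1, a.entry i) ^ (kappa μ).toReal) ∂μ
      + ∫⁻ a, ENNReal.ofReal (∑ i ∈ Finset.range a.1,
          a.entry i ^ (kappa μ).toReal * Real.posLog (a.entry i)) ∂μ < ⊤) ∧
  (2 < kappa μ →
    ∫⁻ a, ENNReal.ofReal ((∑ i ∈ Finset.range a.1, a.entry i) ^ 2) ∂μ < ⊤)

end SubdiffusiveTree

open SubdiffusiveTree

/-! Write x_n for the expected conductance to level n + 1, f(y) = y/(1+y) and L(y) = y - f(y) =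
y²/(1+y). Splitting at the root, the conductance to the next level is Σ A(i) f(C_i), with C_i
independent copies of the conductance C to level n + 1. Since E Σ A(i) = 1, branching preserves
means, so x_{n+1} = x_n - E L(C). Everything rests on bounding the loss E L(C) by a function of x_n
alone.

Normalize, Z_n = C/x_n, and follow h_n(y) = E L(y Z_n). Two facts close a recursion. Applying f and
normalizing again decreases the law in the convex order (`integral_comp_inSeries_le`); and E L(Σ c_i
Z_i) ≤ Σ E L(c_i Z_i) + L(Σ c_i) for independent nonnegative Z_i of mean one
(`integral_seriesLoss_sum_le`). Hence h_{n+1}(y) ≤ E Σ h_n(y A(i)) + E L(y Σ A(i)). A supersolution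
W of this linear recursion dominates every h_n (`lintegral_seriesLoss_levelConductance_le`), and y =
x_n gives x_{n+1} ≥ x_n - W(x_n).

The negative derivative at 1 yields exponents p < κ with E Σ A(i)^p < 1. For κ ≤ 2, E Σ A(i)^κ = 1
makes y^κ invariant, and bending it slightly towards y^p creates a deficit that pays for the source
term (`lintegral_harmonicBarrier_le`, `lintegral_logBarrier_le`). The resulting W is O(y^κ) if κ <
2, and O(y² log(1+1/y)) on (0, 1] if κ = 2; elementary recursions for 1/x_n then give the rates.

For κ > 2 one has E Σ A(i)² < 1, so M_n converges in L². The same convex comparison, applied to the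
square, gives E Z_n² ≤ E M_{n+1}² ≤ V = E M_∞². By Cauchy–Schwarz E f(C) ≥ x_n/(1 + V x_n), that is
1/x_{n+1} ≤ 1/x_n + V, which produces the constant 1/V. -/

namespace SubdiffusiveTree

/-! ### Recursive structure of the tree -/

/-- The tree of descendants of the `i`-th child of the root. -/
def subtree (t : WeightedTree) (i : ℕ) : WeightedTree := fun y => t (y ++ [i])

/-- The sum of `F` over the subtrees at the children of the root, weighted by the first-level
weights. -/
noncomputable def branchSum (F : WeightedTree → ℝ) (t : WeightedTree) : ℝ :=
  ∑ i ∈ Finset.range (t []).1, (t []).entry i * F (subtree t i)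

/-- The conductance to the `n + 1`-st level, defined by recursion on the subtrees. -/
noncomputable def levelConductance : ℕ → WeightedTree → ℝ
  | 0 => branchSum fun _ => 1
  | n + 1 => branchSum fun t => levelConductance n t / (1 + levelConductance n t)

/-- The additive martingale, defined by recursion on the subtrees. -/
noncomputable def branchMartingale : ℕ → WeightedTree → ℝ
  | 0 => fun _ => 1
  | n + 1 => branchSum (branchMartingale n)

theorem entry_nonneg (a : WeightSeq) (i : ℕ) : 0 ≤ a.entry i := by
  by_cases h : i < a.1
  · exact (entry_pos a h).le
  · simp [WeightSeq.entry, h]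

theorem branchSum_nonneg {F : WeightedTree → ℝ} (hF : ∀ t, 0 ≤ F t) (t : WeightedTree) :
    0 ≤ branchSum F t :=
  Finset.sum_nonneg fun _ _ => mul_nonneg (entry_nonneg _ _) (hF _)

theorem escape_subtree (t : WeightedTree) (j m : ℕ) (y : Word) :
    escape (subtree t j) m y = escape t m (y ++ [j]) := by
  induction m generalizing y with
  | zero => rfl
  | succ m ih => simp only [escape_succ, ih]; rfl

/-- The edge above the root has conductance 1 and is in series with everything below it. The current
through the children of the root does not meet this edge, so `levelConductance` has no such factor
at its outermost step. -/
theorem escape_succ_nil (t : WeightedTree) (n : ℕ) :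
    escape t (n + 1) [] = levelConductance n t / (1 + levelConductance n t) := by
  induction n generalizing t with
  | zero => simp [escape, levelConductance, branchSum]
  | succ n ih =>
    rw [escape_succ]
    have h (i : ℕ) : escape t (n + 1) [i] = escape (subtree t i) (n + 1) [] :=
      (escape_subtree t i (n + 1) []).symm
    simp only [h, ih]
    rfl

theorem levelConductance_nonneg (n : ℕ) (t : WeightedTree) : 0 ≤ levelConductance n t := by
  induction n generalizing t with
  | zero => exact branchSum_nonneg (fun _ => zero_le_one) t
  | succ n ih =>
    exact branchSum_nonneg (fun t => div_nonneg (ih t) (add_nonneg zero_le_one (ih t))) t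

theorem effectiveConductance_succ (t : WeightedTree) (n : ℕ) :
    effectiveConductance t (n + 1) = levelConductance n t := by
  obtain ⟨v, hv⟩ := exists_isPotential t (n + 1) (by omega) 1
  have h := totalCurrent_eq (by omega) hv
  rw [hv.totalCurrent_eq_escape (by omega), mul_one, mul_one, Nat.add_sub_cancel] at h
  rw [← h]
  cases n with
  | zero => simp [levelConductance, branchSum, escape]
  | succ n =>
    refine Finset.sum_congr rfl fun i _ => ?_
    beta_reduce
    rw [← escape_succ_nil, escape_subtree]; rfl

/-- The total conductance of the edges at depth `m` below `x`, relative to that of `x`. -/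
noncomputable def massBelow (t : WeightedTree) : ℕ → Word → ℝ
  | 0, _ => 1
  | m + 1, x => ∑ i ∈ Finset.range (t x).1, (t x).entry i * massBelow t m (i :: x)

theorem massBelow_subtree (t : WeightedTree) (j m : ℕ) (y : Word) :
    massBelow (subtree t j) m y = massBelow t m (y ++ [j]) := by
  induction m generalizing y with
  | zero => rfl
  | succ m ih => simp only [massBelow, ih]; rfl

theorem massBelow_nil (t : WeightedTree) (n : ℕ) : massBelow t n [] = branchMartingale n t := by
  induction n generalizing t with
  | zero => rfl
  | succ n ih =>
    refine Finset.sum_congr rfl fun i _ => ?_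
    rw [← ih, massBelow_subtree]; rfl

theorem sum_level_succ (t : WeightedTree) (n : ℕ) (g : Word → ℝ) :
    ∑ x ∈ level t (n + 1), g x
      = ∑ x ∈ level t n, ∑ i ∈ Finset.range (t x).1, g (i :: x) := by
  rw [level, Finset.sum_biUnion]
  · refine Finset.sum_congr rfl fun x _ => ?_
    rw [Finset.sum_image]
    intro i _ j _ h
    exact (List.cons.inj h).1
  · intro x _ y _ hxy
    simp only [Function.onFun, Finset.disjoint_left, Finset.mem_image]
    rintro _ ⟨i, _, rfl⟩ ⟨j, _, h⟩
    exact hxy (List.cons.inj h).2.symm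

/-- Interpolates between the two ways of growing the tree: m = 0 is the sum over a level, built by
adding leaves, and n = 0 is the recursion at the root. One generation is moved at a time. -/
theorem sum_level_massBelow (t : WeightedTree) (n m : ℕ) :
    ∑ x ∈ level t n, conductance t x * massBelow t m x = massBelow t (n + m) [] := by
  induction n generalizing m with
  | zero => simp [level, conductance]
  | succ n ih =>
    rw [sum_level_succ, show n + 1 + m = n + (m + 1) by omega, ← ih]
    refine Finset.sum_congr rfl fun x _ => ?_
    simp only [massBelow, conductance, Finset.mul_sum, mul_assoc]

theorem additiveMartingale_eq (t : WeightedTree) (n : ℕ) :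
    additiveMartingale t n = branchMartingale n t := by
  rw [← massBelow_nil, ← Nat.add_zero n, ← sum_level_massBelow]
  simp [additiveMartingale, massBelow]

/-! ### Measurability -/

theorem measurable_of_forall_mk {β : Type*} [MeasurableSpace β] {f : WeightSeq → β}
    (h : ∀ k, Measurable fun v : Fin k → Set.Ioi (0 : ℝ) => f ⟨k, v⟩) : Measurable f := by
  intro s hs
  rw [Sigma.instMeasurableSpace, MeasurableSpace.measurableSet_iInf]
  exact fun k => h k hs

theorem measurable_length : Measurable fun a : WeightSeq => a.1 :=
  measurable_of_forall_mk fun _ => measurable_const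

theorem measurable_entry (i : ℕ) : Measurable fun a : WeightSeq => a.entry i := by
  refine measurable_of_forall_mk fun k => ?_
  by_cases h : i < k
  · simp only [WeightSeq.entry, h, dite_true]
    exact measurable_subtype_coe.comp (measurable_pi_apply (⟨i, h⟩ : Fin k))
  · simp only [WeightSeq.entry, h, dite_false]
    fun_prop

/-- The random number of terms takes countably many values, so it can be treated as a separate
discrete coordinate. -/
theorem measurable_sum_range {β γ : Type*} [MeasurableSpace β] [MeasurableSpace γ]
    [AddCommMonoid γ] [MeasurableAdd₂ γ] {N : β → ℕ} (hN : Measurable N) {f : ℕ → β → γ}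
    (hf : ∀ i, Measurable (f i)) : Measurable fun b => ∑ i ∈ Finset.range (N b), f i b := by
  have h : Measurable fun p : ℕ × β => ∑ i ∈ Finset.range p.1, f i p.2 := by
    refine measurable_from_prod_countable_right fun n => ?_
    exact Finset.measurable_sum (Finset.range n) fun i _ => hf i
  exact h.comp (hN.prodMk measurable_id)

theorem measurable_sum_entry {γ : Type*} [MeasurableSpace γ] [AddCommMonoid γ]
    [MeasurableAdd₂ γ] {φ : ℝ → γ} (hφ : Measurable φ) :
    Measurable fun a : WeightSeq => ∑ i ∈ Finset.range a.1, φ (a.entry i) :=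
  measurable_sum_range measurable_length fun i => hφ.comp (measurable_entry i)

theorem measurable_subtree (i : ℕ) : Measurable fun t : WeightedTree => subtree t i :=
  measurable_pi_lambda _ fun y => measurable_pi_apply (y ++ [i])

theorem measurable_branchSum {F : WeightedTree → ℝ} (hF : Measurable F) :
    Measurable (branchSum F) :=
  measurable_sum_range (measurable_length.comp (measurable_pi_apply [])) fun i =>
    ((measurable_entry i).comp (measurable_pi_apply [])).mul (hF.comp (measurable_subtree i))

theorem measurable_levelConductance (n : ℕ) : Measurable (levelConductance n) := by
  induction n with
  | zero => exact measurable_branchSum measurable_const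
  | succ n ih => exact measurable_branchSum (ih.div (ih.const_add 1))

theorem measurable_branchMartingale (n : ℕ) : Measurable (branchMartingale n) := by
  induction n with
  | zero => exact measurable_const
  | succ n ih => exact measurable_branchSum ih

/-! ### The law of the tree -/

/-- The law of a tree with independent weight sequences of law `μ`. -/
noncomputable def treeLaw (μ : Measure WeightSeq) : Measure WeightedTree :=
  Measure.infinitePi fun _ : Word => μ

/-- The law of an independent sequence of trees. -/
noncomputable def forestLaw (μ : Measure WeightSeq) : Measure (ℕ → WeightedTree) :=
  Measure.infinitePi fun _ : ℕ => treeLaw μ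

instance (μ : Measure WeightSeq) [IsProbabilityMeasure μ] : IsProbabilityMeasure (treeLaw μ) := by
  unfold treeLaw; infer_instance

instance (μ : Measure WeightSeq) [IsProbabilityMeasure μ] :
    IsProbabilityMeasure (forestLaw μ) := by
  unfold forestLaw; infer_instance

/-- The tree with weight sequence `a` at the root and subtree `s i` at the `i`-th child. -/
def graft (p : WeightSeq × (ℕ → WeightedTree)) : WeightedTree := fun x =>
  if h : x = [] then p.1 else p.2 (x.getLast h) x.dropLast

theorem graft_nil (p : WeightSeq × (ℕ → WeightedTree)) : graft p [] = p.1 := by simp [graft]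

theorem graft_append (p : WeightSeq × (ℕ → WeightedTree)) (y : Word) (i : ℕ) :
    graft p (y ++ [i]) = p.2 i y := by simp [graft]

theorem subtree_graft (p : WeightSeq × (ℕ → WeightedTree)) (i : ℕ) :
    subtree (graft p) i = p.2 i := funext fun y => graft_append p y i

theorem measurable_graft : Measurable graft := by
  refine measurable_pi_lambda _ fun x => ?_
  by_cases h : x = []
  · simpa [graft, h] using measurable_fst
  · simp only [graft, h, dite_false]
    exact (measurable_pi_apply _).comp ((measurable_pi_apply _).comp measurable_snd)

/-- The law of the sequences of weights, read off along the words. -/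
theorem map_eq_treeLaw {μ : Measure WeightSeq} {Ω : Type*} [MeasurableSpace Ω] {P : Measure Ω}
    [IsProbabilityMeasure P]
    {A : Word → Ω → WeightSeq} (hmeas : ∀ x, Measurable (A x))
    (hlaw : ∀ x, P.map (A x) = μ) (hindep : iIndepFun A P) :
    P.map (fun ω x => A x ω) = treeLaw μ := by
  rw [hindep.map_fun_eq_infinitePi_map hmeas]
  simp only [hlaw, treeLaw]

section Law

variable (μ : Measure WeightSeq) [IsProbabilityMeasure μ]

/-- The branching property: the root sequence is independent of the subtrees, which are i.i.d.
copies of the tree. A nonempty word is uniquely `y ++ [i]`, so grafting only relabels the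
coordinates of a product measure; it is enough to compare boxes with finitely many constrained
coordinates. -/
theorem map_graft : (μ.prod (forestLaw μ)).map graft = treeLaw μ := by
  classical
  refine Measure.eq_infinitePi _ fun S T hT => ?_
  let e : ℕ × Word → Word := fun p => p.2 ++ [p.1]
  have he : Function.Injective e := by
    rintro ⟨i, x⟩ ⟨j, y⟩ h
    have := List.append_inj' h rfl
    simp_all
  let S' : Finset (ℕ × Word) := S.preimage e he.injOn
  -- The default 0 is never reached, as x is nonempty.
  have hS : ∀ x : Word, x ≠ [] → e (x.getLast?.getD 0, x.dropLast) = x := by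
    intro x hx
    simp only [e, List.getLast?_eq_getLast_of_ne_nil hx, Option.getD_some]
    exact List.dropLast_append_getLast hx
  have hpre : graft ⁻¹' (Set.pi S T) = (if [] ∈ S then T [] else Set.univ) ×ˢ
      ((MeasurableEquiv.curry ℕ Word WeightSeq).symm ⁻¹' (Set.pi S' fun p => T (e p))) := by
    ext ⟨a, s⟩
    simp only [Set.mem_preimage, Set.mem_pi, Set.mem_prod, Finset.mem_coe]
    constructor
    · intro h
      refine ⟨?_, fun p hp => ?_⟩
      · split_ifs with h0
        · simpa [graft_nil] using h [] h0
        · trivial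
      · have := h (e p) (Finset.mem_preimage.1 hp)
        rwa [graft_append] at this
    · rintro ⟨h1, h2⟩ x hx
      by_cases h0 : x = []
      · subst h0
        simpa [hx, graft_nil] using h1
      · have h3 := hS x h0
        have := h2 _ (Finset.mem_preimage.2 (h3.symm ▸ hx))
        rw [h3] at this
        rw [← h3, graft_append, h3]
        exact this
  have hms : MeasurableSet (Set.pi (S' : Set (ℕ × Word)) fun p => T (e p)) :=
    .pi S'.countable_toSet fun p _ => hT _
  have hF : (forestLaw μ) ((MeasurableEquiv.curry ℕ Word WeightSeq).symm ⁻¹'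
      (Set.pi S' fun p => T (e p))) = ∏ p ∈ S', μ (T (e p)) := by
    rw [← MeasurableEquiv.map_apply]
    have := Measure.infinitePi_map_curry_symm (ι := ℕ) (κ := Word) fun _ _ => μ
    unfold forestLaw treeLaw
    rw [this, Measure.infinitePi_pi _ fun p _ => hT _]
  rw [Measure.map_apply measurable_graft (.pi S.countable_toSet fun x _ => hT x), hpre,
    Measure.prod_prod, hF]
  have h1 : ∏ p ∈ S', μ (T (e p)) = ∏ x ∈ S.erase [], μ (T x) := by
    refine Finset.prod_nbij e (fun p hp => ?_) he.injOn (fun x hx => ?_) fun _ _ => rfl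
    · exact Finset.mem_erase.2 ⟨by simp [e], Finset.mem_preimage.1 hp⟩
    · have hx := Finset.mem_erase.1 hx
      exact ⟨_, Finset.mem_preimage.2 ((hS x hx.1).symm ▸ hx.2), hS x hx.1⟩
  rw [h1]
  split_ifs with h0
  · exact Finset.mul_prod_erase S (fun x => μ (T x)) h0
  · rw [measure_univ, one_mul, Finset.erase_eq_of_notMem h0]

/-- Decomposition of the tree at its root. -/
theorem lintegral_treeLaw {Φ : WeightedTree → ENNReal} (hΦ : Measurable Φ) :
    ∫⁻ t, Φ t ∂(treeLaw μ) = ∫⁻ a, ∫⁻ s, Φ (graft (a, s)) ∂(forestLaw μ) ∂μ := by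
  rw [← map_graft, lintegral_map hΦ measurable_graft,
    lintegral_prod (fun p => Φ (graft p)) (hΦ.comp measurable_graft).aemeasurable]

theorem branchSum_graft (F : WeightedTree → ℝ) (a : WeightSeq) (s : ℕ → WeightedTree) :
    branchSum F (graft (a, s)) = ∑ i ∈ Finset.range a.1, a.entry i * F (s i) := by
  simp only [branchSum, graft_nil, subtree_graft]

theorem lintegral_forestLaw_eval (i : ℕ) {Φ : WeightedTree → ENNReal} (hΦ : Measurable Φ) :
    ∫⁻ s, Φ (s i) ∂(forestLaw μ) = ∫⁻ t, Φ t ∂(treeLaw μ) :=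
  (measurePreserving_eval_infinitePi (fun _ : ℕ => treeLaw μ) i).lintegral_comp hΦ

theorem measurePreserving_eval_forestLaw (i : ℕ) :
    MeasurePreserving (fun s : ℕ → WeightedTree => s i) (forestLaw μ) (treeLaw μ) :=
  measurePreserving_eval_infinitePi (fun _ : ℕ => treeLaw μ) i

theorem iIndepFun_forestLaw {F : WeightedTree → ℝ} (hF : Measurable F) :
    iIndepFun (fun (i : ℕ) (s : ℕ → WeightedTree) => F (s i)) (forestLaw μ) :=
  iIndepFun_infinitePi (P := fun _ : ℕ => treeLaw μ) (X := fun _ => F) fun _ => hF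

end Law

/-! ### Adding a unit conductance in series -/

/-- The conductance of `y` in series with a unit conductance. -/
noncomputable def inSeries (y : ℝ) : ℝ := y / (1 + y)

/-- The decrease of the conductance `y` when a unit conductance is added in series. -/
noncomputable def seriesLoss (y : ℝ) : ℝ := y ^ 2 / (1 + y)

theorem inSeries_nonneg {y : ℝ} (hy : 0 ≤ y) : 0 ≤ inSeries y := by unfold inSeries; positivity

theorem seriesLoss_nonneg {y : ℝ} (hy : 0 ≤ y) : 0 ≤ seriesLoss y := by
  unfold seriesLoss; positivity

theorem inSeries_add_seriesLoss {y : ℝ} (hy : 0 ≤ y) : inSeries y + seriesLoss y = y := by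
  unfold inSeries seriesLoss; field_simp

theorem mul_inSeries (y : ℝ) : y * inSeries y = seriesLoss y := by
  unfold inSeries seriesLoss; ring

theorem inSeries_le {y : ℝ} (hy : 0 ≤ y) : inSeries y ≤ y := by
  linarith [inSeries_add_seriesLoss hy, seriesLoss_nonneg hy]

theorem seriesLoss_le {y : ℝ} (hy : 0 ≤ y) : seriesLoss y ≤ y := by
  linarith [inSeries_add_seriesLoss hy, inSeries_nonneg hy]

theorem seriesLoss_le_sq {y : ℝ} (hy : 0 ≤ y) : seriesLoss y ≤ y ^ 2 := by
  unfold seriesLoss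
  exact div_le_self (sq_nonneg y) (by linarith)

theorem inSeries_le_one {y : ℝ} (hy : 0 ≤ y) : inSeries y ≤ 1 := by
  unfold inSeries
  rw [div_le_one (by linarith)]; linarith

theorem inSeries_mono {x y : ℝ} (hx : 0 ≤ x) (hxy : x ≤ y) : inSeries x ≤ inSeries y := by
  unfold inSeries
  rw [div_le_div_iff₀ (by linarith) (by linarith)]; nlinarith

theorem inSeries_add_le {x y : ℝ} (hx : 0 ≤ x) (hy : 0 ≤ y) :
    inSeries (x + y) ≤ inSeries x + inSeries y := by
  unfold inSeries
  rw [add_div]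
  gcongr <;> linarith

/-- Concavity with an explicit remainder. Taking r to be the mean and integrating is Jensen's
inequality. -/
theorem inSeries_le_tangent {x r : ℝ} (hx : 0 ≤ x) (hr : 0 ≤ r) :
    inSeries x ≤ inSeries r + (x - r) / (1 + r) ^ 2 := by
  have h : inSeries r + (x - r) / (1 + r) ^ 2 - inSeries x
      = (x - r) ^ 2 / ((1 + x) * (1 + r) ^ 2) := by
    unfold inSeries; field_simp; ring
  have : 0 ≤ (x - r) ^ 2 / ((1 + x) * (1 + r) ^ 2) := by positivity
  linarith

theorem measurable_inSeries : Measurable inSeries := by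
  unfold inSeries; fun_prop

theorem measurable_seriesLoss : Measurable seriesLoss := by
  unfold seriesLoss; fun_prop

/-- Expand L(S) = S f(S) = Σ y_i f(S) and use subadditivity, f(S) ≤ f(y_i) + f(S - y_i). The form is
chosen so that, for independent y_i, each cross term is a product of independent factors. -/
theorem seriesLoss_sum_le (s : Finset ℕ) {y : ℕ → ℝ} (hy : ∀ i, 0 ≤ y i) :
    seriesLoss (∑ i ∈ s, y i)
      ≤ ∑ i ∈ s, (seriesLoss (y i) + inSeries (∑ j ∈ s.erase i, y j) * y i) := by
  rw [← mul_inSeries, Finset.sum_mul]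
  refine Finset.sum_le_sum fun i hi => ?_
  have h := inSeries_add_le (hy i) (Finset.sum_nonneg fun j (_ : j ∈ s.erase i) => hy j)
  rw [Finset.add_sum_erase s y hi] at h
  rw [← mul_inSeries]
  nlinarith [mul_le_mul_of_nonneg_left h (hy i)]

/-! ### Weighted sums of independent variables -/

section Independent

variable {Ω : Type*} [MeasurableSpace Ω] {P : Measure Ω}
  {Z : ℕ → Ω → ℝ}

theorem integrable_seriesLoss {X : Ω → ℝ} (hX : Integrable X P) (h0 : ∀ ω, 0 ≤ X ω) :
    Integrable (fun ω => seriesLoss (X ω)) P := by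
  refine hX.mono (measurable_seriesLoss.comp_aemeasurable hX.aemeasurable).aestronglyMeasurable
    (ae_of_all _ fun ω => ?_)
  rw [Real.norm_of_nonneg (seriesLoss_nonneg (h0 ω)), Real.norm_of_nonneg (h0 ω)]
  exact seriesLoss_le (h0 ω)

theorem integrable_inSeries {X : Ω → ℝ} (hX : Integrable X P) (h0 : ∀ ω, 0 ≤ X ω) :
    Integrable (fun ω => inSeries (X ω)) P := by
  refine hX.mono (measurable_inSeries.comp_aemeasurable hX.aemeasurable).aestronglyMeasurable
    (ae_of_all _ fun ω => ?_)
  rw [Real.norm_of_nonneg (inSeries_nonneg (h0 ω)), Real.norm_of_nonneg (h0 ω)]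
  exact inSeries_le (h0 ω)

theorem integral_inSeries_le [IsProbabilityMeasure P] {X : Ω → ℝ} (hX : Integrable X P) (h0 : ∀ ω, 0 ≤ X ω) :
    ∫ ω, inSeries (X ω) ∂P ≤ inSeries (∫ ω, X ω ∂P) := by
  have hr : 0 ≤ ∫ ω, X ω ∂P := integral_nonneg h0
  have h1 : Integrable (fun ω => X ω - ∫ ω, X ω ∂P) P := hX.sub (integrable_const _)
  have h : ∫ ω, inSeries (X ω) ∂P
      ≤ ∫ ω, (inSeries (∫ ω, X ω ∂P) + (X ω - ∫ ω, X ω ∂P) / (1 + ∫ ω, X ω ∂P) ^ 2) ∂P := by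
    refine integral_mono (integrable_inSeries hX h0) ?_ fun ω => inSeries_le_tangent (h0 ω) hr
    exact (integrable_const _).add (h1.div_const _)
  rw [integral_add (integrable_const _) (h1.div_const _),
    integral_div, integral_sub hX (integrable_const _)] at h
  simpa using h

/-- By independence and Jensen, the i-th cross term is at most c_i f(Σ c_j); these bounds add up to
L(Σ c_j). -/
theorem integral_seriesLoss_sum_le [IsProbabilityMeasure P] (hm : ∀ i, Measurable (Z i)) (hi : iIndepFun Z P)
    (h0 : ∀ i ω, 0 ≤ Z i ω) (hint : ∀ i, Integrable (Z i) P) (h1 : ∀ i, ∫ ω, Z i ω ∂P = 1)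
    {c : ℕ → ℝ} (hc : ∀ i, 0 ≤ c i) (s : Finset ℕ) :
    ∫ ω, seriesLoss (∑ i ∈ s, c i * Z i ω) ∂P
      ≤ ∑ i ∈ s, ∫ ω, seriesLoss (c i * Z i ω) ∂P + seriesLoss (∑ i ∈ s, c i) := by
  have hY0 (i ω) : 0 ≤ c i * Z i ω := mul_nonneg (hc i) (h0 i ω)
  have hYi (i) : Integrable (fun ω => c i * Z i ω) P := (hint i).const_mul _
  have hYm (i) : Measurable (fun ω => c i * Z i ω) := (hm i).const_mul _
  have hind : iIndepFun (fun i ω => c i * Z i ω) P :=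
    hi.comp (fun i z => c i * z) fun i => measurable_const_mul (c i)
  have hR0 (i ω) : 0 ≤ ∑ j ∈ s.erase i, c j * Z j ω := Finset.sum_nonneg fun j _ => hY0 j ω
  have hRi (i) : Integrable (fun ω => ∑ j ∈ s.erase i, c j * Z j ω) P :=
    integrable_finsetSum _ fun j _ => hYi j
  have hsplit (i) : IndepFun (fun ω => inSeries (∑ j ∈ s.erase i, c j * Z j ω))
      (fun ω => c i * Z i ω) P := by
    have h := hind.indepFun_finsetSum_of_notMem hYm (s := s.erase i) (i := i) (by simp)
    have h2 := h.comp measurable_inSeries measurable_id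
    simpa [Function.comp_def] using h2
  have hprod (i) : Integrable (fun ω => inSeries (∑ j ∈ s.erase i, c j * Z j ω) * (c i * Z i ω)) P :=
    (hsplit i).integrable_mul (integrable_inSeries (hRi i) (hR0 i)) (hYi i)
  have hcross (i) (hi : i ∈ s) :
      ∫ ω, inSeries (∑ j ∈ s.erase i, c j * Z j ω) * (c i * Z i ω) ∂P
        ≤ c i * inSeries (∑ j ∈ s, c j) := by
    rw [(hsplit i).integral_fun_mul_eq_mul_integral
      (integrable_inSeries (hRi i) (hR0 i)).aestronglyMeasurable (hYi i).aestronglyMeasurable,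
      integral_const_mul, h1, mul_one, mul_comm]
    refine mul_le_mul_of_nonneg_left ?_ (hc i)
    refine (integral_inSeries_le (hRi i) (hR0 i)).trans ?_
    rw [integral_finsetSum _ fun j _ => hYi j]
    simp only [integral_const_mul, h1, mul_one]
    refine inSeries_mono (Finset.sum_nonneg fun j _ => hc j) ?_
    exact Finset.sum_le_sum_of_subset_of_nonneg (Finset.erase_subset i s) fun j _ _ => hc j
  calc ∫ ω, seriesLoss (∑ i ∈ s, c i * Z i ω) ∂P
      ≤ ∫ ω, ∑ i ∈ s, (seriesLoss (c i * Z i ω)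
          + inSeries (∑ j ∈ s.erase i, c j * Z j ω) * (c i * Z i ω)) ∂P := by
        refine integral_mono (integrable_seriesLoss (integrable_finsetSum _ fun j _ => hYi j)
          fun ω => Finset.sum_nonneg fun j _ => hY0 j ω) ?_ fun ω =>
            seriesLoss_sum_le s fun i => hY0 i ω
        exact integrable_finsetSum _ fun i _ =>
          (integrable_seriesLoss (hYi i) (hY0 i)).add (hprod i)
    _ = ∑ i ∈ s, (∫ ω, seriesLoss (c i * Z i ω) ∂P
          + ∫ ω, inSeries (∑ j ∈ s.erase i, c j * Z j ω) * (c i * Z i ω) ∂P) := by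
        rw [integral_finsetSum (f := fun i ω => seriesLoss (c i * Z i ω)
          + inSeries (∑ j ∈ s.erase i, c j * Z j ω) * (c i * Z i ω)) _ fun i _ =>
          (integrable_seriesLoss (hYi i) (hY0 i)).add (hprod i)]
        exact Finset.sum_congr rfl fun i _ =>
          integral_add (integrable_seriesLoss (hYi i) (hY0 i)) (hprod i)
    _ ≤ ∑ i ∈ s, (∫ ω, seriesLoss (c i * Z i ω) ∂P + c i * inSeries (∑ j ∈ s, c j)) :=
        Finset.sum_le_sum fun i hi => add_le_add le_rfl (hcross i hi)
    _ = _ := by rw [Finset.sum_add_distrib, ← Finset.sum_mul, mul_inSeries]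

theorem integral_sq_sum (hi : iIndepFun Z P) (hL : ∀ i, MemLp (Z i) 2 P) {v w : ℝ}
    (hv : ∀ i, ∫ ω, Z i ω ^ 2 ∂P = v) (hw : ∀ i, ∫ ω, Z i ω ∂P = w) (c : ℕ → ℝ)
    (s : Finset ℕ) :
    ∫ ω, (∑ i ∈ s, c i * Z i ω) ^ 2 ∂P
      = (∑ i ∈ s, c i ^ 2) * v + ((∑ i ∈ s, c i) ^ 2 - ∑ i ∈ s, c i ^ 2) * w ^ 2 := by
  have hint (i j) : Integrable (fun ω => Z i ω * Z j ω) P := (hL i).integrable_mul (hL j)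
  have hij (i j) : ∫ ω, Z i ω * Z j ω ∂P = w ^ 2 + if i = j then v - w ^ 2 else 0 := by
    split_ifs with h
    · subst h
      simp only [← sq, hv]; ring
    · rw [(hi.indepFun h).integral_fun_mul_eq_mul_integral (hL i).1 (hL j).1, hw, hw]; ring
  have hexp (ω) : (∑ i ∈ s, c i * Z i ω) ^ 2
      = ∑ i ∈ s, ∑ j ∈ s, c i * c j * (Z i ω * Z j ω) := by
    rw [sq, Finset.sum_mul_sum]
    exact Finset.sum_congr rfl fun i _ => Finset.sum_congr rfl fun j _ => by ring
  simp only [hexp]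
  rw [integral_finsetSum _ fun i _ => integrable_finsetSum _ fun j _ => (hint i j).const_mul _]
  have h2 (i) (hi : i ∈ s) : ∫ ω, ∑ j ∈ s, c i * c j * (Z i ω * Z j ω) ∂P
      = (∑ j ∈ s, c i * c j) * w ^ 2 + c i ^ 2 * (v - w ^ 2) := by
    rw [integral_finsetSum _ fun j _ => (hint i j).const_mul _]
    simp only [integral_const_mul, hij, mul_add, Finset.sum_add_distrib, mul_ite, mul_zero,
      Finset.sum_ite_eq, hi, if_true, ← Finset.sum_mul]
    ring
  rw [Finset.sum_congr rfl h2, Finset.sum_add_distrib, ← Finset.sum_mul, ← Finset.sum_mul,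
    ← Finset.sum_mul_sum]
  ring

end Independent

/-! ### Comparison in the convex order -/

/-- `φ` has supporting lines on `[0, ∞)`, in a form that is convenient to compare two values on
the same side of the point of contact. -/
def HasSupportSlopes (φ : ℝ → ℝ) : Prop :=
  ∀ w, 0 ≤ w → ∃ l : ℝ, ∀ u v, 0 ≤ u → 0 ≤ v → (w ≤ u ∧ u ≤ v ∨ v ≤ u ∧ u ≤ w) →
    l * (v - u) ≤ φ v - φ u

theorem hasSupportSlopes_sq : HasSupportSlopes fun u => u ^ 2 := by
  refine fun w hw => ⟨2 * w, fun u v hu hv h => ?_⟩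
  rcases h with ⟨h1, h2⟩ | ⟨h1, h2⟩ <;> nlinarith

theorem hasSupportSlopes_seriesLoss {c : ℝ} (hc : 0 ≤ c) :
    HasSupportSlopes fun u => seriesLoss (c * u) := by
  -- The slope is the derivative of u ↦ L(cu) at w.
  refine fun w hw => ⟨c - c / (1 + c * w) ^ 2, fun u v hu hv h => ?_⟩
  have hcu : 0 ≤ c * u := by positivity
  have hcv : 0 ≤ c * v := by positivity
  have hcw : 0 ≤ c * w := by positivity
  have hd : seriesLoss (c * v) - seriesLoss (c * u)
      = c * (v - u) - c * (v - u) / ((1 + c * u) * (1 + c * v)) := by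
    unfold seriesLoss; field_simp; ring
  rw [hd, sub_mul, div_mul_eq_mul_div]
  refine sub_le_sub_left ?_ _
  rcases h with ⟨h1, h2⟩ | ⟨h1, h2⟩
  · have h3 : c * w ≤ c * u := mul_le_mul_of_nonneg_left h1 hc
    have h4 : c * u ≤ c * v := mul_le_mul_of_nonneg_left h2 hc
    have h5 : 0 ≤ c * (v - u) := mul_nonneg hc (by linarith)
    rw [sq]
    gcongr
    linarith
  · have h3 : c * u ≤ c * w := mul_le_mul_of_nonneg_left h2 hc
    have h4 : c * v ≤ c * u := mul_le_mul_of_nonneg_left h1 hc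
    have h5 : 0 ≤ c * (u - v) := mul_nonneg hc (by linarith)
    have h6 : c * (u - v) / (1 + c * w) ^ 2 ≤ c * (u - v) / ((1 + c * u) * (1 + c * v)) := by
      rw [sq]
      gcongr
      linarith
    have h7 : c * (v - u) = -(c * (u - v)) := by ring
    rw [h7, neg_div, neg_div]
    linarith

section Comparison

variable {Ω : Type*} [MeasurableSpace Ω] {P : Measure Ω} {X : Ω → ℝ}

theorem integral_inSeries_pos (hX : Integrable X P) (h0 : ∀ ω, 0 ≤ X ω)
    (hpos : 0 < ∫ ω, X ω ∂P) : 0 < ∫ ω, inSeries (X ω) ∂P := by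
  rw [integral_pos_iff_support_of_nonneg (fun ω => inSeries_nonneg (h0 ω))
    (integrable_inSeries hX h0)]
  rw [integral_pos_iff_support_of_nonneg h0 hX] at hpos
  convert hpos using 2
  ext ω
  have := h0 ω
  simp only [Function.mem_support, inSeries]
  rw [div_ne_zero_iff]
  exact ⟨fun h => h.1, fun h => ⟨h, by positivity⟩⟩

/-- The law of `X / (1 + X)`, normalized, is less dispersed than that of `X`, normalized. -/
theorem integral_comp_inSeries_le (hX : Integrable X P) (h0 : ∀ ω, 0 ≤ X ω)
    (hpos : 0 < ∫ ω, X ω ∂P) {φ : ℝ → ℝ} (hφ : HasSupportSlopes φ)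
    (h1 : Integrable (fun ω => φ (inSeries (X ω) / ∫ ω, inSeries (X ω) ∂P)) P)
    (h2 : Integrable (fun ω => φ (X ω / ∫ ω, X ω ∂P)) P) :
    ∫ ω, φ (inSeries (X ω) / ∫ ω, inSeries (X ω) ∂P) ∂P
      ≤ ∫ ω, φ (X ω / ∫ ω, X ω ∂P) ∂P := by
  have hβ := integral_inSeries_pos hX h0 hpos
  have hβα : ∫ ω, inSeries (X ω) ∂P ≤ ∫ ω, X ω ∂P :=
    integral_mono (integrable_inSeries hX h0) hX fun ω => inSeries_le (h0 ω)
  have hi1 : Integrable (fun ω => X ω / ∫ ω, X ω ∂P) P := hX.div_const _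
  have hi2 : Integrable (fun ω => inSeries (X ω) / ∫ ω, inSeries (X ω) ∂P) P :=
    (integrable_inSeries hX h0).div_const _
  have hm1 : ∫ ω, X ω / (∫ ω, X ω ∂P) ∂P = 1 := by
    rw [integral_div, div_self hpos.ne']
  have hm2 : ∫ ω, inSeries (X ω) / (∫ ω, inSeries (X ω) ∂P) ∂P = 1 := by
    rw [integral_div, div_self hβ.ne']
  generalize (∫ ω, X ω ∂P) = α at *
  generalize (∫ ω, inSeries (X ω) ∂P) = β at *
  -- The functions x/α and f(x)/β cross at x = α/β - 1, with common value w = (α/β - 1)/α. On either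
  -- side of the crossing, x/α lies beyond f(x)/β as seen from w, which is exactly the configuration
  -- of `HasSupportSlopes`. Integrating, the linear term vanishes because both variables have mean
  -- one.
  have hw : 0 ≤ (α / β - 1) / α := by
    have : 1 ≤ α / β := by rwa [one_le_div hβ]
    exact div_nonneg (by linarith) hpos.le
  obtain ⟨l, hl⟩ := hφ _ hw
  have hpt (ω) : l * (X ω / α - inSeries (X ω) / β)
      ≤ φ (X ω / α) - φ (inSeries (X ω) / β) := by
    have hx := h0 ω
    refine hl _ _ (div_nonneg (inSeries_nonneg hx) hβ.le) (div_nonneg hx hpos.le) ?_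
    have e1 : inSeries (X ω) / β - (α / β - 1) / α
        = (X ω - (α / β - 1)) / (α * (1 + X ω)) := by
      unfold inSeries; field_simp; ring
    have e2 : X ω / α - inSeries (X ω) / β
        = X ω * (X ω - (α / β - 1)) / (α * (1 + X ω)) := by
      unfold inSeries; field_simp; ring
    have hp : 0 ≤ (α * (1 + X ω)) := by positivity
    rcases le_total (α / β - 1) (X ω) with h | h
    · left
      have := div_nonneg (sub_nonneg.2 h) hp
      have := div_nonneg (mul_nonneg hx (sub_nonneg.2 h)) hp
      constructor <;> linarith
    · right
      have := div_nonpos_of_nonpos_of_nonneg (sub_nonpos.2 h) hp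
      have := div_nonpos_of_nonpos_of_nonneg (mul_nonpos_of_nonneg_of_nonpos hx
        (sub_nonpos.2 h)) hp
      constructor <;> linarith
  have h := integral_mono ((hi1.sub hi2).const_mul l) (h2.sub h1) hpt
  simp only [Pi.sub_apply] at h
  rw [integral_const_mul, integral_sub hi1 hi2, integral_sub h2 h1, hm1, hm2] at h
  linarith

end Comparison

/-! ### Expectations of branching sums -/

section BranchSum

theorem measurable_totalWeight :
    Measurable fun a : WeightSeq => ∑ i ∈ Finset.range a.1, a.entry i :=
  measurable_sum_entry measurable_id

variable (μ : Measure WeightSeq) [IsProbabilityMeasure μ]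

theorem lintegral_branchSum {F : WeightedTree → ℝ} (hF : Measurable F) (h0 : ∀ t, 0 ≤ F t) :
    ∫⁻ t, ENNReal.ofReal (branchSum F t) ∂(treeLaw μ)
      = (∫⁻ a, ENNReal.ofReal (∑ i ∈ Finset.range a.1, a.entry i) ∂μ)
        * ∫⁻ t, ENNReal.ofReal (F t) ∂(treeLaw μ) := by
  rw [lintegral_treeLaw μ (measurable_branchSum hF).ennreal_ofReal,
    ← lintegral_mul_const _ measurable_totalWeight.ennreal_ofReal]
  refine lintegral_congr fun a => ?_
  simp only [branchSum_graft]
  rw [ENNReal.ofReal_sum_of_nonneg fun i _ => entry_nonneg a i, Finset.sum_mul]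
  have h (s : ℕ → WeightedTree) :
      ENNReal.ofReal (∑ i ∈ Finset.range a.1, a.entry i * F (s i))
        = ∑ i ∈ Finset.range a.1, ENNReal.ofReal (a.entry i) * ENNReal.ofReal (F (s i)) := by
    rw [ENNReal.ofReal_sum_of_nonneg fun i _ => mul_nonneg (entry_nonneg a i) (h0 _)]
    exact Finset.sum_congr rfl fun i _ => ENNReal.ofReal_mul (entry_nonneg a i)
  simp only [h]
  have hm (i : ℕ) : Measurable fun s : ℕ → WeightedTree => ENNReal.ofReal (F (s i)) :=
    (hF.comp (measurable_pi_apply i)).ennreal_ofReal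
  rw [lintegral_finsetSum _ fun i _ => (hm i).const_mul _]
  refine Finset.sum_congr rfl fun i _ => ?_
  rw [lintegral_const_mul _ (hm i),
    lintegral_forestLaw_eval μ i (Φ := fun t => ENNReal.ofReal (F t)) hF.ennreal_ofReal]

/-- Condition on the weights at the root and apply `integral_seriesLoss_sum_le` with coefficients y
A(i). Working in `ENNReal` removes any integrability question for the outer expectation. -/
theorem lintegral_seriesLoss_branchSum_le {Z : WeightedTree → ℝ} (hm : Measurable Z)
    (h0 : ∀ t, 0 ≤ Z t) (hint : Integrable Z (treeLaw μ)) (h1 : ∫ t, Z t ∂(treeLaw μ) = 1)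
    {y : ℝ} (hy : 0 ≤ y) :
    ∫⁻ t, ENNReal.ofReal (seriesLoss (y * branchSum Z t)) ∂(treeLaw μ)
      ≤ ∫⁻ a, ∑ i ∈ Finset.range a.1,
          ∫⁻ t, ENNReal.ofReal (seriesLoss (y * a.entry i * Z t)) ∂(treeLaw μ) ∂μ
        + ∫⁻ a, ENNReal.ofReal (seriesLoss (y * ∑ i ∈ Finset.range a.1, a.entry i)) ∂μ := by
  have hms : Measurable fun a : WeightSeq =>
      ENNReal.ofReal (seriesLoss (y * ∑ i ∈ Finset.range a.1, a.entry i)) :=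
    (measurable_seriesLoss.comp (measurable_totalWeight.const_mul y)).ennreal_ofReal
  rw [lintegral_treeLaw μ (Φ := fun t => ENNReal.ofReal (seriesLoss (y * branchSum Z t)))
    (measurable_seriesLoss.comp ((measurable_branchSum hm).const_mul y)).ennreal_ofReal, ← lintegral_add_right _ hms]
  refine lintegral_mono fun a => ?_
  have hc (i) : 0 ≤ y * a.entry i := mul_nonneg hy (entry_nonneg a i)
  have hZi (i) : Integrable (fun s : ℕ → WeightedTree => Z (s i)) (forestLaw μ) :=
    (measurePreserving_eval_forestLaw μ i).integrable_comp_of_integrable hint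
  have hev (i) (G : WeightedTree → ℝ) (hG : Measurable G) :
      ∫ s, G (s i) ∂(forestLaw μ) = ∫ t, G t ∂(treeLaw μ) := by
    rw [← (measurePreserving_eval_forestLaw μ i).map_eq,
      integral_map (measurePreserving_eval_forestLaw μ i).measurable.aemeasurable
        hG.aestronglyMeasurable]
  have key := integral_seriesLoss_sum_le (P := forestLaw μ) (Z := fun i s => Z (s i))
    (fun i => hm.comp (measurable_pi_apply i)) (iIndepFun_forestLaw μ hm) (fun i s => h0 _)
    hZi (fun i => by rw [hev i Z hm, h1]) hc (Finset.range a.1)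
  have hs (s : ℕ → WeightedTree) : y * branchSum Z (graft (a, s))
      = ∑ i ∈ Finset.range a.1, y * a.entry i * Z (s i) := by
    rw [branchSum_graft, Finset.mul_sum]
    exact Finset.sum_congr rfl fun i _ => by ring
  simp only [hs]
  have hpos (s : ℕ → WeightedTree) : 0 ≤ ∑ i ∈ Finset.range a.1, y * a.entry i * Z (s i) :=
    Finset.sum_nonneg fun i _ => mul_nonneg (hc i) (h0 _)
  rw [← ofReal_integral_eq_lintegral_ofReal
    (integrable_seriesLoss (integrable_finsetSum _ fun i _ => (hZi i).const_mul _) hpos)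
    (ae_of_all _ fun s => seriesLoss_nonneg (hpos s))]
  refine (ENNReal.ofReal_le_ofReal key).trans ?_
  have hcZ (i t) : 0 ≤ y * a.entry i * Z t := mul_nonneg (hc i) (h0 t)
  rw [ENNReal.ofReal_add (Finset.sum_nonneg fun i _ => integral_nonneg fun s =>
      seriesLoss_nonneg (hcZ i _)) (seriesLoss_nonneg (Finset.sum_nonneg fun i _ => hc i)),
    ENNReal.ofReal_sum_of_nonneg fun i _ => integral_nonneg fun s => seriesLoss_nonneg (hcZ i _),
    Finset.mul_sum]
  refine add_le_add (Finset.sum_le_sum fun i _ => ?_) le_rfl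
  rw [hev i (fun t => seriesLoss (y * a.entry i * Z t))
      (measurable_seriesLoss.comp (hm.const_mul _)),
    ofReal_integral_eq_lintegral_ofReal (integrable_seriesLoss (hint.const_mul _) (hcZ i))
      (ae_of_all _ fun t => seriesLoss_nonneg (hcZ i t))]

theorem lintegral_sq_branchSum {F : WeightedTree → ℝ} (hm : Measurable F)
    (hL : MemLp F 2 (treeLaw μ)) :
    ∫⁻ t, ENNReal.ofReal (branchSum F t ^ 2) ∂(treeLaw μ)
      = (∫⁻ a, ENNReal.ofReal (∑ i ∈ Finset.range a.1, a.entry i ^ 2) ∂μ)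
          * ENNReal.ofReal (∫ t, F t ^ 2 ∂(treeLaw μ))
        + (∫⁻ a, ENNReal.ofReal ((∑ i ∈ Finset.range a.1, a.entry i) ^ 2
            - ∑ i ∈ Finset.range a.1, a.entry i ^ 2) ∂μ)
          * ENNReal.ofReal ((∫ t, F t ∂(treeLaw μ)) ^ 2) := by
  have hm2 : Measurable fun a : WeightSeq => ∑ i ∈ Finset.range a.1, a.entry i ^ 2 :=
    measurable_sum_entry (measurable_id.pow_const 2)
  have hm3 : Measurable fun a : WeightSeq => (∑ i ∈ Finset.range a.1, a.entry i) ^ 2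
      - ∑ i ∈ Finset.range a.1, a.entry i ^ 2 := (measurable_totalWeight.pow_const 2).sub hm2
  rw [lintegral_treeLaw μ ((measurable_branchSum hm).pow_const 2).ennreal_ofReal,
    ← lintegral_mul_const _ hm2.ennreal_ofReal,
    ← lintegral_mul_const _ hm3.ennreal_ofReal,
    ← lintegral_add_left (hm2.ennreal_ofReal.mul_const _)]
  refine lintegral_congr fun a => ?_
  simp only [branchSum_graft]
  have hLi (i) : MemLp (fun s : ℕ → WeightedTree => F (s i)) 2 (forestLaw μ) :=
    hL.comp_measurePreserving (measurePreserving_eval_forestLaw μ i)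
  have hev (i) (G : WeightedTree → ℝ) (hG : Measurable G) :
      ∫ s, G (s i) ∂(forestLaw μ) = ∫ t, G t ∂(treeLaw μ) := by
    rw [← (measurePreserving_eval_forestLaw μ i).map_eq,
      integral_map (measurePreserving_eval_forestLaw μ i).measurable.aemeasurable
        hG.aestronglyMeasurable]
  have hsum : MemLp (fun s : ℕ → WeightedTree => ∑ i ∈ Finset.range a.1, a.entry i * F (s i))
      2 (forestLaw μ) := memLp_finsetSum _ fun i _ => (hLi i).const_mul _
  rw [← ofReal_integral_eq_lintegral_ofReal hsum.integrable_sq (ae_of_all _ fun _ => sq_nonneg _),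
    integral_sq_sum (iIndepFun_forestLaw μ hm) hLi
      (fun i => hev i (fun t => F t ^ 2) (hm.pow_const 2)) (fun i => hev i F hm)]
  have hsq : 0 ≤ ∑ i ∈ Finset.range a.1, a.entry i ^ 2 :=
    Finset.sum_nonneg fun i _ => sq_nonneg _
  have hd : 0 ≤ (∑ i ∈ Finset.range a.1, a.entry i) ^ 2
      - ∑ i ∈ Finset.range a.1, a.entry i ^ 2 :=
    sub_nonneg.2 (Finset.sum_sq_le_sq_sum_of_nonneg fun i _ => entry_nonneg a i)
  rw [ENNReal.ofReal_add (mul_nonneg hsq (integral_nonneg fun _ => sq_nonneg _))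
    (mul_nonneg hd (sq_nonneg _)), ENNReal.ofReal_mul hsq, ENNReal.ofReal_mul hd]

end BranchSum

/-! ### The expected conductance -/

/-- The expected conductance between the root and level `n + 1`. -/
noncomputable def expectedConductance (μ : Measure WeightSeq) (n : ℕ) : ℝ :=
  ∫ t, levelConductance n t ∂(treeLaw μ)

section Mass

variable {μ : Measure WeightSeq} [IsProbabilityMeasure μ]

theorem integrable_branchSum
    (hmass : ∫⁻ a, ENNReal.ofReal (∑ i ∈ Finset.range a.1, a.entry i) ∂μ = 1)
    {F : WeightedTree → ℝ} (hm : Measurable F)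
    (h0 : ∀ t, 0 ≤ F t) (hF : Integrable F (treeLaw μ)) :
    Integrable (branchSum F) (treeLaw μ) := by
  rw [← lintegral_ofReal_ne_top_iff_integrable (measurable_branchSum hm).aestronglyMeasurable
    (ae_of_all _ (branchSum_nonneg h0)), lintegral_branchSum μ hm h0, hmass, one_mul,
    lintegral_ofReal_ne_top_iff_integrable hm.aestronglyMeasurable (ae_of_all _ h0)]
  exact hF

theorem integral_branchSum
    (hmass : ∫⁻ a, ENNReal.ofReal (∑ i ∈ Finset.range a.1, a.entry i) ∂μ = 1)
    {F : WeightedTree → ℝ} (hm : Measurable F) (h0 : ∀ t, 0 ≤ F t) :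
    ∫ t, branchSum F t ∂(treeLaw μ) = ∫ t, F t ∂(treeLaw μ) := by
  rw [integral_eq_lintegral_of_nonneg_ae (ae_of_all _ (branchSum_nonneg h0))
      (measurable_branchSum hm).aestronglyMeasurable, lintegral_branchSum μ hm h0, hmass, one_mul,
    integral_eq_lintegral_of_nonneg_ae (ae_of_all _ h0) hm.aestronglyMeasurable]

theorem levelConductance_succ (n : ℕ) :
    levelConductance (n + 1) = branchSum fun t => inSeries (levelConductance n t) := rfl

theorem measurable_inSeries_levelConductance (n : ℕ) :
    Measurable fun t => inSeries (levelConductance n t) :=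
  measurable_inSeries.comp (measurable_levelConductance n)

theorem integrable_levelConductance
    (hmass : ∫⁻ a, ENNReal.ofReal (∑ i ∈ Finset.range a.1, a.entry i) ∂μ = 1) (n : ℕ) :
    Integrable (levelConductance n) (treeLaw μ) := by
  induction n with
  | zero =>
    exact integrable_branchSum hmass measurable_const (fun _ => zero_le_one) (integrable_const _)
  | succ n ih =>
    exact integrable_branchSum hmass (measurable_inSeries_levelConductance n)
      (fun t => inSeries_nonneg (levelConductance_nonneg n t))
      (integrable_inSeries ih (levelConductance_nonneg n))

theorem expectedConductance_zero
    (hmass : ∫⁻ a, ENNReal.ofReal (∑ i ∈ Finset.range a.1, a.entry i) ∂μ = 1) :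
    expectedConductance μ 0 = 1 := by
  rw [expectedConductance, levelConductance,
    integral_branchSum hmass measurable_const fun _ => zero_le_one]
  simp

theorem expectedConductance_succ
    (hmass : ∫⁻ a, ENNReal.ofReal (∑ i ∈ Finset.range a.1, a.entry i) ∂μ = 1) (n : ℕ) :
    expectedConductance μ (n + 1) = ∫ t, inSeries (levelConductance n t) ∂(treeLaw μ) :=
  integral_branchSum hmass (measurable_inSeries_levelConductance n)
    fun t => inSeries_nonneg (levelConductance_nonneg n t)

theorem expectedConductance_pos
    (hmass : ∫⁻ a, ENNReal.ofReal (∑ i ∈ Finset.range a.1, a.entry i) ∂μ = 1) (n : ℕ) :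
    0 < expectedConductance μ n := by
  induction n with
  | zero => rw [expectedConductance_zero hmass]; exact one_pos
  | succ n ih =>
    rw [expectedConductance_succ hmass]
    exact integral_inSeries_pos (integrable_levelConductance hmass n) (levelConductance_nonneg n) ih

/-- Averaging over the root weights costs nothing because they have total mean one; the only loss
comes from the unit conductance added in series above each subtree. -/
theorem expectedConductance_succ_eq_sub
    (hmass : ∫⁻ a, ENNReal.ofReal (∑ i ∈ Finset.range a.1, a.entry i) ∂μ = 1) (n : ℕ) :
    expectedConductance μ (n + 1)
      = expectedConductance μ n - ∫ t, seriesLoss (levelConductance n t) ∂(treeLaw μ) := by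
  have hi := integrable_levelConductance hmass n
  rw [expectedConductance_succ hmass, eq_sub_iff_add_eq, ← integral_add
    (integrable_inSeries hi (levelConductance_nonneg n))
    (integrable_seriesLoss hi (levelConductance_nonneg n))]
  exact integral_congr_ae (ae_of_all _ fun t =>
    inSeries_add_seriesLoss (levelConductance_nonneg n t))

theorem expectedConductance_succ_le
    (hmass : ∫⁻ a, ENNReal.ofReal (∑ i ∈ Finset.range a.1, a.entry i) ∂μ = 1) (n : ℕ) :
    expectedConductance μ (n + 1) ≤ expectedConductance μ n := by
  rw [expectedConductance_succ_eq_sub hmass]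
  exact sub_le_self _ (integral_nonneg fun t => seriesLoss_nonneg (levelConductance_nonneg n t))

theorem branchSum_div (F : WeightedTree → ℝ) (c : ℝ) (t : WeightedTree) :
    branchSum (fun t => F t / c) t = branchSum F t / c := by
  simp only [branchSum, Finset.sum_div, mul_div_assoc]

/-- Supersolutions of the linear recursion dominate the expected loss of the normalized
conductances. -/
theorem lintegral_seriesLoss_levelConductance_le
    (hmass : ∫⁻ a, ENNReal.ofReal (∑ i ∈ Finset.range a.1, a.entry i) ∂μ = 1)
    {W : ℝ → ENNReal}
    (hW : ∀ y, 0 < y → ∫⁻ a, ∑ i ∈ Finset.range a.1, W (y * a.entry i) ∂μ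
      + ∫⁻ a, ENNReal.ofReal (seriesLoss (y * ∑ i ∈ Finset.range a.1, a.entry i)) ∂μ ≤ W y)
    (n : ℕ) {y : ℝ} (hy : 0 < y) :
    ∫⁻ t, ENNReal.ofReal (seriesLoss
      (y * (levelConductance n t / expectedConductance μ n))) ∂(treeLaw μ) ≤ W y := by
  induction n generalizing y with
  | zero =>
    -- At the first level the conductance is the sum of the root weights, of mean one, so its loss
    -- is the source term alone.
    refine le_trans ?_ ((self_le_add_left _ _).trans (hW y hy))
    rw [lintegral_treeLaw μ (Φ := fun t => ENNReal.ofReal (seriesLoss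
      (y * (levelConductance 0 t / expectedConductance μ 0)))) (measurable_seriesLoss.comp
      (((measurable_levelConductance 0).div_const _).const_mul y)).ennreal_ofReal]
    simp [expectedConductance_zero hmass, levelConductance, branchSum_graft]
  | succ n ih =>
    have hi := integrable_levelConductance hmass n
    have h0 := levelConductance_nonneg n
    have hx := expectedConductance_pos hmass n
    have hx1 := expectedConductance_pos hmass (n + 1)
    have hm := measurable_inSeries_levelConductance n
    have hb := lintegral_seriesLoss_branchSum_le μ
      (Z := fun t => inSeries (levelConductance n t) / expectedConductance μ (n + 1))
      (hm.div_const _)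
      (fun t => div_nonneg (inSeries_nonneg (h0 t)) hx1.le)
      ((integrable_inSeries hi h0).div_const _)
      (by rw [integral_div, ← expectedConductance_succ hmass, div_self hx1.ne']) hy.le
    simp only [branchSum_div] at hb
    rw [levelConductance_succ]
    refine hb.trans ((add_le_add (lintegral_mono fun a => Finset.sum_le_sum fun i hia => ?_)
      le_rfl).trans (hW y hy))
    have hpos : 0 < y * a.entry i := mul_pos hy (entry_pos a (Finset.mem_range.1 hia))
    -- The branching inequality involves f(C) normalized, the induction hypothesis C normalized; the
    -- comparison in the convex order bridges the two.
    refine le_trans ?_ (ih hpos)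
    have hn1 (t) : 0 ≤ y * a.entry i *
        (inSeries (levelConductance n t) / expectedConductance μ (n + 1)) :=
      mul_nonneg hpos.le (div_nonneg (inSeries_nonneg (h0 t)) hx1.le)
    have hn2 (t) : 0 ≤ y * a.entry i * (levelConductance n t / expectedConductance μ n) :=
      mul_nonneg hpos.le (div_nonneg (h0 t) hx.le)
    have hi1 := integrable_seriesLoss (((integrable_inSeries hi h0).div_const
      (expectedConductance μ (n + 1))).const_mul (y * a.entry i)) hn1
    have hi2 := integrable_seriesLoss ((hi.div_const
      (expectedConductance μ n)).const_mul (y * a.entry i)) hn2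
    rw [← ofReal_integral_eq_lintegral_ofReal hi1 (ae_of_all _ fun t => seriesLoss_nonneg (hn1 t)),
      ← ofReal_integral_eq_lintegral_ofReal hi2 (ae_of_all _ fun t => seriesLoss_nonneg (hn2 t))]
    refine ENNReal.ofReal_le_ofReal ?_
    rw [expectedConductance_succ hmass] at hi1 ⊢
    exact integral_comp_inSeries_le hi h0 hx (hasSupportSlopes_seriesLoss hpos.le) hi1 hi2

/-- Lower bound for the expected conductance after one more level, in terms of a supersolution. -/
theorem le_expectedConductance_succ
    (hmass : ∫⁻ a, ENNReal.ofReal (∑ i ∈ Finset.range a.1, a.entry i) ∂μ = 1)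
    {W : ℝ → ENNReal}
    (hW : ∀ y, 0 < y → ∫⁻ a, ∑ i ∈ Finset.range a.1, W (y * a.entry i) ∂μ
      + ∫⁻ a, ENNReal.ofReal (seriesLoss (y * ∑ i ∈ Finset.range a.1, a.entry i)) ∂μ ≤ W y)
    {w : ℝ → ℝ} (hw : ∀ y, 0 < y → 0 ≤ w y) (hWw : ∀ y, 0 < y → W y ≤ ENNReal.ofReal (w y))
    (n : ℕ) :
    expectedConductance μ n - w (expectedConductance μ n) ≤ expectedConductance μ (n + 1) := by
  have hx := expectedConductance_pos hmass n
  have h := (lintegral_seriesLoss_levelConductance_le hmass hW n hx).trans (hWw _ hx)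
  -- Choosing y equal to the mean undoes the normalization.
  simp only [mul_div_cancel₀ _ hx.ne'] at h
  rw [← ofReal_integral_eq_lintegral_ofReal (integrable_seriesLoss
      (integrable_levelConductance hmass n) (levelConductance_nonneg n))
      (ae_of_all _ fun t => seriesLoss_nonneg (levelConductance_nonneg n t)),
    ENNReal.ofReal_le_ofReal_iff (hw _ hx)] at h
  rw [expectedConductance_succ_eq_sub hmass]
  linarith

end Mass

/-! ### Moments of the weights -/

/-- The moment `E[∑ A(i)^s]`. -/
noncomputable def weightMoment (μ : Measure WeightSeq) (s : ℝ) : ENNReal :=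
  ∫⁻ a, ENNReal.ofReal (∑ i ∈ Finset.range a.1, a.entry i ^ s) ∂μ

theorem psi_eq_zero_iff {μ : Measure WeightSeq} {s : ℝ} : psi μ s = 0 ↔ weightMoment μ s = 1 :=
  ENNReal.log_eq_one_iff

theorem weightMoment_one (μ : Measure WeightSeq) :
    weightMoment μ 1 = ∫⁻ a, ENNReal.ofReal (∑ i ∈ Finset.range a.1, a.entry i) ∂μ := by
  simp [weightMoment]

theorem measurable_powerSum (s : ℝ) :
    Measurable fun a : WeightSeq => ∑ i ∈ Finset.range a.1, a.entry i ^ s :=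
  measurable_sum_entry (measurable_id.pow_const s)

theorem powerSum_nonneg (s : ℝ) (a : WeightSeq) :
    0 ≤ ∑ i ∈ Finset.range a.1, a.entry i ^ s :=
  Finset.sum_nonneg fun i _ => Real.rpow_nonneg (entry_nonneg a i) s

theorem rpow_convexComb_le {x : ℝ} (hx : 0 < x) (u v : ℝ) {θ : ℝ} (h0 : 0 ≤ θ) (h1 : θ ≤ 1) :
    x ^ ((1 - θ) * u + θ * v) ≤ (1 - θ) * x ^ u + θ * x ^ v := by
  have h := Real.geom_mean_le_arith_mean2_weighted (sub_nonneg.2 h1) h0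
    (Real.rpow_nonneg hx.le u) (Real.rpow_nonneg hx.le v) (by ring)
  rwa [← Real.rpow_mul hx.le, ← Real.rpow_mul hx.le, ← Real.rpow_add hx, mul_comm u,
    mul_comm v] at h

theorem powerSum_convexComb_le (a : WeightSeq) (u v : ℝ) {θ : ℝ} (h0 : 0 ≤ θ) (h1 : θ ≤ 1) :
    ∑ i ∈ Finset.range a.1, a.entry i ^ ((1 - θ) * u + θ * v)
      ≤ (1 - θ) * ∑ i ∈ Finset.range a.1, a.entry i ^ u
        + θ * ∑ i ∈ Finset.range a.1, a.entry i ^ v := by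
  rw [Finset.mul_sum, Finset.mul_sum, ← Finset.sum_add_distrib]
  exact Finset.sum_le_sum fun i hi =>
    rpow_convexComb_le (entry_pos a (Finset.mem_range.1 hi)) u v h0 h1

theorem weightMoment_convexComb_le (μ : Measure WeightSeq) (u v : ℝ) {θ : ℝ} (h0 : 0 ≤ θ)
    (h1 : θ ≤ 1) : weightMoment μ ((1 - θ) * u + θ * v)
      ≤ ENNReal.ofReal (1 - θ) * weightMoment μ u + ENNReal.ofReal θ * weightMoment μ v := by
  unfold weightMoment
  rw [← lintegral_const_mul _ (measurable_powerSum u).ennreal_ofReal,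
    ← lintegral_const_mul _ (measurable_powerSum v).ennreal_ofReal,
    ← lintegral_add_left ((measurable_powerSum u).ennreal_ofReal.const_mul _)]
  refine lintegral_mono fun a => ?_
  rw [← ENNReal.ofReal_mul (sub_nonneg.2 h1), ← ENNReal.ofReal_mul h0,
    ← ENNReal.ofReal_add (mul_nonneg (sub_nonneg.2 h1) (powerSum_nonneg u a))
      (mul_nonneg h0 (powerSum_nonneg v a))]
  exact ENNReal.ofReal_le_ofReal (powerSum_convexComb_le a u v h0 h1)

/-- If `m(u) < 1` and `m(v) ≤ 1` then `m < 1` strictly between `u` and `v`. -/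
theorem weightMoment_lt_one_of_mem_Ioo {μ : Measure WeightSeq} {u v s : ℝ} (hus : u < s) (hsv : s < v)
    (hu : weightMoment μ u < 1) (hv : weightMoment μ v ≤ 1) : weightMoment μ s < 1 := by
  have hd : 0 < v - u := by linarith
  have h0 : 0 ≤ (s - u) / (v - u) := div_nonneg (by linarith) hd.le
  have h1 : (s - u) / (v - u) < 1 := (div_lt_one hd).2 (by linarith)
  have h := weightMoment_convexComb_le μ u v h0 h1.le
  rw [show (1 - (s - u) / (v - u)) * u + (s - u) / (v - u) * v = s by field_simp; ring] at h
  refine h.trans_lt ?_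
  calc _ < ENNReal.ofReal (1 - (s - u) / (v - u)) * 1 + ENNReal.ofReal ((s - u) / (v - u)) * 1 := by
        refine ENNReal.add_lt_add_of_lt_of_le ?_ ?_ ?_
        · exact (ENNReal.mul_lt_top ENNReal.ofReal_lt_top (hv.trans_lt ENNReal.one_lt_top)).ne
        · refine ENNReal.mul_lt_mul_right ?_ ENNReal.ofReal_ne_top hu
          exact (ENNReal.ofReal_pos.2 (by linarith)).ne'
        · gcongr
    _ = 1 := by
        rw [mul_one, mul_one, ← ENNReal.ofReal_add (by linarith) h0]
        simp

theorem hasDerivAt_rpow_exponent {x : ℝ} (hx : 0 < x) :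
    HasDerivAt (fun s : ℝ => x ^ s) (x * Real.log x) 1 := by
  simpa using (Real.hasStrictDerivAt_const_rpow hx 1).hasDerivAt

/-- The right derivative at 1 of s ↦ E Σ A(i)^s is negative, possibly -∞. If the moment stayed at
least 1 on (1, q), the difference quotients would have negative parts of integral at most that of
their positive parts. Dominated convergence for the positive parts and Fatou for the negative ones
carry this to the limit, against `HDerivative`. -/
theorem exists_weightMoment_lt_one {μ : Measure WeightSeq} (h1 : weightMoment μ 1 = 1) (hder : HDerivative μ)
    {q : ℝ} (hq : 1 < q) (hqf : weightMoment μ q ≠ ⊤) : ∃ p, 1 < p ∧ p < q ∧ weightMoment μ p < 1 := by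
  by_contra! hcon
  have hq0 : 0 < q - 1 := by linarith
  -- The shift by 2 keeps 1 + e n strictly below q already for n = 0.
  let e : ℕ → ℝ := fun n => (q - 1) / (n + 2)
  have he0 (n) : 0 < e n := by positivity
  have he1 (n) : e n < q - 1 := div_lt_self hq0 (by linarith [n.cast_nonneg (α := ℝ)])
  have hel : Tendsto e atTop (𝓝 0) :=
    tendsto_const_nhds.div_atTop (tendsto_atTop_add_const_right _ _ tendsto_natCast_atTop_atTop)
  let D : ℕ → WeightSeq → ℝ := fun n a =>
    (∑ i ∈ Finset.range a.1, a.entry i ^ (1 + e n) - ∑ i ∈ Finset.range a.1, a.entry i ^ (1 : ℝ))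
      / e n
  have hDm (n) : Measurable (D n) :=
    ((measurable_powerSum _).sub (measurable_powerSum _)).div_const _
  have hDlim (a : WeightSeq) : Tendsto (fun n => D n a) atTop
      (𝓝 (∑ i ∈ Finset.range a.1, a.entry i * Real.log (a.entry i))) := by
    have hD (n) : D n a = ∑ i ∈ Finset.range a.1,
        (e n)⁻¹ • (a.entry i ^ (1 + e n) - a.entry i ^ (1 : ℝ)) := by
      simp only [D, ← Finset.sum_sub_distrib, Finset.mul_sum, smul_eq_mul, div_eq_inv_mul]
    simp only [hD]
    refine tendsto_finsetSum _ fun i hi => ?_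
    have hd := (hasDerivAt_iff_tendsto_slope_zero.1
      (hasDerivAt_rpow_exponent (entry_pos a (Finset.mem_range.1 hi))))
    exact hd.comp (tendsto_nhdsWithin_iff.2 ⟨hel, Eventually.of_forall fun n => (he0 n).ne'⟩)
  -- Convexity in the exponent bounds the quotient by the slope of the chord from 1 to q; the term
  -- at 1 is then dropped.
  have hDle (n a) : D n a ≤ (q - 1)⁻¹ * ∑ i ∈ Finset.range a.1, a.entry i ^ q := by
    have h0 : 0 ≤ e n / (q - 1) := (div_pos (he0 n) hq0).le
    have h := powerSum_convexComb_le a 1 q h0 ((div_lt_one hq0).2 (he1 n)).le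
    rw [show (1 - e n / (q - 1)) * 1 + e n / (q - 1) * q = 1 + e n by field_simp; ring] at h
    rw [div_le_iff₀ (he0 n)]
    have h2 := mul_nonneg h0 (powerSum_nonneg 1 a)
    calc _ ≤ e n / (q - 1) * ∑ i ∈ Finset.range a.1, a.entry i ^ q := by linarith
      _ = _ := by ring
  have hle (n) : ∫⁻ a, ENNReal.ofReal (-D n a) ∂μ ≤ ∫⁻ a, ENNReal.ofReal (D n a) ∂μ := by
    have hc : ENNReal.ofReal (e n)⁻¹ ≠ ⊤ := ENNReal.ofReal_ne_top
    -- Rearranged so that both sides are sums of nonnegative terms: the integrals can be compared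
    -- without first knowing that the quotient is integrable.
    have hsplit (a) : ENNReal.ofReal (-D n a) + ENNReal.ofReal (e n)⁻¹ *
          ENNReal.ofReal (∑ i ∈ Finset.range a.1, a.entry i ^ (1 + e n))
        = ENNReal.ofReal (D n a) + ENNReal.ofReal (e n)⁻¹ *
          ENNReal.ofReal (∑ i ∈ Finset.range a.1, a.entry i ^ (1 : ℝ)) := by
      have hc0 : 0 ≤ (e n)⁻¹ := (inv_pos.2 (he0 n)).le
      rw [← ENNReal.ofReal_mul hc0, ← ENNReal.ofReal_mul hc0]
      have hDn : D n a = (e n)⁻¹ * ∑ i ∈ Finset.range a.1, a.entry i ^ (1 + e n)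
          - (e n)⁻¹ * ∑ i ∈ Finset.range a.1, a.entry i ^ (1 : ℝ) := by
        simp only [D]; ring
      have n1 := mul_nonneg hc0 (powerSum_nonneg (1 + e n) a)
      have n2 := mul_nonneg hc0 (powerSum_nonneg 1 a)
      rcases le_total 0 (D n a) with h | h
      · rw [ENNReal.ofReal_of_nonpos (neg_nonpos.2 h), zero_add, ← ENNReal.ofReal_add h n2]
        congr 1; linarith
      · rw [ENNReal.ofReal_of_nonpos h, zero_add, ← ENNReal.ofReal_add (neg_nonneg.2 h) n1]
        congr 1; linarith
    have hint := lintegral_congr (μ := μ) hsplit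
    have hDneg : Measurable fun a => -D n a := (hDm n).neg
    rw [lintegral_add_left hDneg.ennreal_ofReal, lintegral_add_left (hDm n).ennreal_ofReal,
      lintegral_const_mul _ (measurable_powerSum _).ennreal_ofReal,
      lintegral_const_mul _ (measurable_powerSum _).ennreal_ofReal] at hint
    change _ + _ * weightMoment μ (1 + e n) = _ + _ * weightMoment μ 1 at hint
    rw [h1, mul_one] at hint
    have hm := hcon (1 + e n) (by linarith [he0 n]) (by linarith [he1 n])
    refine ENNReal.le_of_add_le_add_right hc (le_trans ?_ hint.le)
    gcongr
    exact le_mul_of_one_le_right' hm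
  have hpos : Tendsto (fun n => ∫⁻ a, ENNReal.ofReal (D n a) ∂μ) atTop
      (𝓝 (∫⁻ a, ENNReal.ofReal
        (∑ i ∈ Finset.range a.1, a.entry i * Real.log (a.entry i)) ∂μ)) := by
    refine tendsto_lintegral_of_dominated_convergence
      (fun a => ENNReal.ofReal (q - 1)⁻¹ * ENNReal.ofReal (∑ i ∈ Finset.range a.1, a.entry i ^ q))
      (fun n => (hDm n).ennreal_ofReal) (fun n => ae_of_all _ fun a => ?_) ?_
      (ae_of_all _ fun a => ENNReal.tendsto_ofReal (hDlim a))
    · beta_reduce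
      rw [← ENNReal.ofReal_mul (inv_pos.2 hq0).le]
      exact ENNReal.ofReal_le_ofReal (hDle n a)
    · rw [lintegral_const_mul _ (measurable_powerSum _).ennreal_ofReal]
      exact ENNReal.mul_ne_top ENNReal.ofReal_ne_top hqf
  have hneg : ∫⁻ a, ENNReal.ofReal
        (-∑ i ∈ Finset.range a.1, a.entry i * Real.log (a.entry i)) ∂μ
      ≤ liminf (fun n => ∫⁻ a, ENNReal.ofReal (-D n a) ∂μ) atTop := by
    refine le_trans (lintegral_mono fun a => ?_)
      (lintegral_liminf_le fun n => (hDm n).neg.ennreal_ofReal)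
    exact (ENNReal.tendsto_ofReal (hDlim a).neg).liminf_eq.ge
  have hfin := hneg.trans ((liminf_le_liminf (Eventually.of_forall hle)).trans
    hpos.liminf_eq.le)
  exact absurd hder (not_lt.2 hfin)

/-- When `κ` is finite it is a zero of `ψ`. -/
theorem exists_kappa_eq {μ : Measure WeightSeq} (h1 : weightMoment μ 1 = 1) (hder : HDerivative μ)
    (hk : kappa μ ≠ ⊤) : ∃ k : ℝ, kappa μ = k ∧ 1 < k ∧ weightMoment μ k = 1 := by
  have hne : {k : EReal | ∃ s : ℝ, 1 < s ∧ psi μ s = 0 ∧ k = (s : EReal)}.Nonempty := by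
    by_contra h
    rw [Set.not_nonempty_iff_eq_empty] at h
    rw [kappa, h, sInf_empty] at hk
    exact hk rfl
  obtain ⟨_, k, hk1, hpk, rfl⟩ := hne
  refine ⟨k, ?_, hk1, psi_eq_zero_iff.1 hpk⟩
  -- Two zeros u < v are impossible: some p < u has moment below 1, and convexity between p and v
  -- would put the moment at u below 1. The infimum defining κ is thus over a single point.
  have key : ∀ u v : ℝ, 1 < u → u < v → weightMoment μ u = 1 → weightMoment μ v = 1 → False := by
    intro u v hu huv hmu hmv
    obtain ⟨p, -, hpu, hp⟩ := exists_weightMoment_lt_one h1 hder hu (by simp [hmu])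
    exact (weightMoment_lt_one_of_mem_Ioo hpu huv hp hmv.le).ne hmu
  have huniq : {k : EReal | ∃ s : ℝ, 1 < s ∧ psi μ s = 0 ∧ k = (s : EReal)} = {(k : EReal)} := by
    ext x
    constructor
    · rintro ⟨s, hs, hps, rfl⟩
      rw [psi_eq_zero_iff] at hps hpk
      rcases lt_trichotomy s k with h | h | h
      · exact (key s k hs h hps hpk).elim
      · rw [h]; rfl
      · exact (key k s hk1 h hpk hps).elim
    · rintro rfl
      exact ⟨k, hk1, hpk, rfl⟩
  rw [kappa, huniq, sInf_singleton]

/-- Convexity propagates the strict inequality up to k, so p may be taken as close to k as a barrier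
requires. -/
theorem exists_weightMoment_lt_one_near {μ : Measure WeightSeq} (h1 : weightMoment μ 1 = 1)
    (hder : HDerivative μ) {k r : ℝ} (hk : 1 < k) (hmk : weightMoment μ k = 1) (hr : r < k) :
    ∃ p, 1 < p ∧ r ≤ p ∧ p < k ∧ weightMoment μ p < 1 := by
  obtain ⟨p, hp1, hpk, hp⟩ := exists_weightMoment_lt_one h1 hder hk (by simp [hmk])
  rcases le_total r p with h | h
  · exact ⟨p, hp1, h, hpk, hp⟩
  · refine ⟨(r + k) / 2, by linarith, by linarith, by linarith, ?_⟩
    exact weightMoment_lt_one_of_mem_Ioo (by linarith) (by linarith) hp hmk.le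

theorem continuousOn_weightMoment {μ : Measure WeightSeq} {u v : ℝ} (hu : weightMoment μ u ≠ ⊤)
    (hv : weightMoment μ v ≠ ⊤) : ContinuousOn (weightMoment μ) (Set.Icc u v) := by
  intro s hs
  refine tendsto_lintegral_filter_of_dominated_convergence
    (fun a => ENNReal.ofReal (∑ i ∈ Finset.range a.1, a.entry i ^ u)
      + ENNReal.ofReal (∑ i ∈ Finset.range a.1, a.entry i ^ v))
    (Eventually.of_forall fun s => (measurable_powerSum s).ennreal_ofReal) ?_ ?_ ?_
  · refine eventually_mem_nhdsWithin.mono fun s hs => ae_of_all _ fun a => ?_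
    rw [← ENNReal.ofReal_add (powerSum_nonneg u a) (powerSum_nonneg v a),
      ← Finset.sum_add_distrib]
    refine ENNReal.ofReal_le_ofReal (Finset.sum_le_sum fun i hi => ?_)
    have hx := entry_pos a (Finset.mem_range.1 hi)
    have n1 := Real.rpow_nonneg hx.le u
    have n2 := Real.rpow_nonneg hx.le v
    rcases le_total 1 (a.entry i) with h | h
    · linarith [Real.rpow_le_rpow_of_exponent_le h hs.2]
    · linarith [Real.rpow_le_rpow_of_exponent_ge hx h hs.1]
  · rw [lintegral_add_left (measurable_powerSum u).ennreal_ofReal]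
    exact ENNReal.add_ne_top.2 ⟨hu, hv⟩
  · refine ae_of_all _ fun a => ENNReal.tendsto_ofReal (tendsto_finsetSum _ fun i hi => ?_)
    exact ((Real.continuousAt_const_rpow
      (entry_pos a (Finset.mem_range.1 hi)).ne').tendsto).mono_left nhdsWithin_le_nhds

theorem weightMoment_two_le (μ : Measure WeightSeq) : weightMoment μ 2
    ≤ ∫⁻ a, ENNReal.ofReal ((∑ i ∈ Finset.range a.1, a.entry i) ^ 2) ∂μ := by
  refine lintegral_mono fun a => ENNReal.ofReal_le_ofReal ?_
  simp only [Real.rpow_two]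
  exact Finset.sum_sq_le_sq_sum_of_nonneg fun i _ => entry_nonneg a i

/-- Otherwise the moment, below 1 at some p in (1, 2), would return to 1 in [p, 2] by the
intermediate value theorem, forcing κ ≤ 2. -/
theorem weightMoment_two_lt_one {μ : Measure WeightSeq} (h1 : weightMoment μ 1 = 1) (hder : HDerivative μ)
    (hk : 2 < kappa μ) (hf : weightMoment μ 2 ≠ ⊤) : weightMoment μ 2 < 1 := by
  by_contra! h
  obtain ⟨p, hp1, hp2, hp⟩ := exists_weightMoment_lt_one h1 hder one_lt_two hf
  obtain ⟨s, hs, hms⟩ := intermediate_value_Icc hp2.le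
    (continuousOn_weightMoment (hp.trans ENNReal.one_lt_top).ne hf) ⟨hp.le, h⟩
  have hks : kappa μ ≤ (s : EReal) :=
    sInf_le ⟨s, by linarith [hs.1], psi_eq_zero_iff.2 hms, rfl⟩
  have : (2 : EReal) < (s : EReal) := hk.trans_le hks
  have : (2 : ℝ) < s := EReal.coe_lt_coe_iff.1 this
  linarith [hs.2]

/-! ### Supersolutions -/

/-- The majorant of t ↦ W(xt) touches it at t = 1. Its average over the weights is α + β m(p), where
m(p) = E Σ A(i)^p, which falls short of W(x) by (1 - m(p)) β: this deficit is what pays for the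
source term. -/
theorem lintegral_add_le_of_tangent {μ : Measure WeightSeq} {k p : ℝ} (hk : weightMoment μ k = 1)
    (hp : weightMoment μ p < 1) {W : ℝ → ℝ} {x α β : ℝ} (hα : 0 ≤ α) (hβ : 0 ≤ β)
    (hW : ∀ t, 0 < t → W (x * t) ≤ α * t ^ k + β * t ^ p) (hx : α + β ≤ W x) :
    ∫⁻ a, ∑ i ∈ Finset.range a.1, ENNReal.ofReal (W (x * a.entry i)) ∂μ
      + ENNReal.ofReal ((1 - (weightMoment μ p).toReal) * β) ≤ ENNReal.ofReal (W x) := by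
  have hp1 : (weightMoment μ p).toReal < 1 := by
    rw [← ENNReal.toReal_one]
    exact (ENNReal.toReal_lt_toReal hp.ne_top ENNReal.one_ne_top).2 hp
  have hle : ∫⁻ a, ∑ i ∈ Finset.range a.1, ENNReal.ofReal (W (x * a.entry i)) ∂μ
      ≤ ENNReal.ofReal α * weightMoment μ k + ENNReal.ofReal β * weightMoment μ p := by
    unfold weightMoment
    rw [← lintegral_const_mul _ (measurable_powerSum k).ennreal_ofReal,
      ← lintegral_const_mul _ (measurable_powerSum p).ennreal_ofReal,
      ← lintegral_add_left ((measurable_powerSum k).ennreal_ofReal.const_mul _)]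
    refine lintegral_mono fun a => ?_
    rw [← ENNReal.ofReal_mul hα, ← ENNReal.ofReal_mul hβ,
      ← ENNReal.ofReal_add (mul_nonneg hα (powerSum_nonneg k a))
        (mul_nonneg hβ (powerSum_nonneg p a)), Finset.mul_sum, Finset.mul_sum,
      ← Finset.sum_add_distrib, ENNReal.ofReal_sum_of_nonneg fun i _ =>
        add_nonneg (mul_nonneg hα (Real.rpow_nonneg (entry_nonneg a i) k))
          (mul_nonneg hβ (Real.rpow_nonneg (entry_nonneg a i) p))]
    exact Finset.sum_le_sum fun i hi =>
      ENNReal.ofReal_le_ofReal (hW _ (entry_pos a (Finset.mem_range.1 hi)))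
  refine (add_le_add_left hle _).trans ?_
  rw [hk, mul_one, ← ENNReal.ofReal_toReal hp.ne_top, ← ENNReal.ofReal_mul hβ,
    ENNReal.toReal_ofReal ENNReal.toReal_nonneg,
    ← ENNReal.ofReal_add hα (mul_nonneg hβ ENNReal.toReal_nonneg), ← ENNReal.ofReal_add
      (add_nonneg hα (mul_nonneg hβ ENNReal.toReal_nonneg))
      (mul_nonneg (sub_nonneg.2 hp1.le) hβ)]
  exact ENNReal.ofReal_le_ofReal (by linarith)

/-- Supersolution for exponents `k < 2`: half the harmonic mean of `x^k` and `x^p`. -/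
noncomputable def harmonicBarrier (k p x : ℝ) : ℝ := x ^ k * x ^ p / (x ^ k + x ^ p)

/-- Supersolution for the exponent `2`. -/
noncomputable def logBarrier (p x : ℝ) : ℝ := x ^ 2 * Real.log (1 + x ^ (p - 2))

/-- With a = x^k and b = x^p, the function ab/(a+b) is concave and homogeneous of degree one, so its
tangent plane has no constant term; its two parts are the α and β below. The deficit β = b
(a/(a+b))² must dominate L(x) up to a factor: for x ≥ 1 because x ≤ x^p, and for x ≤ 1 because β is
of order x^(2k-p) and 2k - p ≤ 2. -/
theorem lintegral_harmonicBarrier_le {μ : Measure WeightSeq} {k p : ℝ} (hk : weightMoment μ k = 1)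
    (hp : weightMoment μ p < 1) (hp1 : 1 < p) (hpk : p < k) (hpk2 : 2 * k - 2 ≤ p) {x : ℝ}
    (hx : 0 < x) :
    ∫⁻ a, ∑ i ∈ Finset.range a.1, ENNReal.ofReal (harmonicBarrier k p (x * a.entry i)) ∂μ
      + ENNReal.ofReal ((1 - (weightMoment μ p).toReal) / 4 * seriesLoss x)
      ≤ ENNReal.ofReal (harmonicBarrier k p x) := by
  have hm1 : (weightMoment μ p).toReal ≤ 1 := by
    rw [← ENNReal.toReal_one]
    exact ENNReal.toReal_mono ENNReal.one_ne_top hp.le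
  have ha : 0 < x ^ k := Real.rpow_pos_of_pos hx k
  have hb : 0 < x ^ p := Real.rpow_pos_of_pos hx p
  have hloss : seriesLoss x / 4 ≤ x ^ p * (x ^ k / (x ^ k + x ^ p)) ^ 2 := by
    rcases le_total 1 x with h | h
    · have h1 : x ^ p ≤ x ^ k := Real.rpow_le_rpow_of_exponent_le h hpk.le
      have h2 : x ≤ x ^ p := by
        simpa using Real.rpow_le_rpow_of_exponent_le h hp1.le
      have h3 : 1 / 2 ≤ x ^ k / (x ^ k + x ^ p) := by
        rw [div_le_div_iff₀ two_pos (by positivity)]; linarith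
      have h4 : (1 / 2 : ℝ) ^ 2 ≤ (x ^ k / (x ^ k + x ^ p)) ^ 2 := by gcongr
      have h5 := mul_le_mul h2 h4 (by norm_num) hb.le
      linarith [seriesLoss_le hx.le]
    · have h1 : x ^ k ≤ x ^ p := Real.rpow_le_rpow_of_exponent_ge hx h hpk.le
      have h2 : x ^ 2 * x ^ p ≤ (x ^ k) ^ 2 := by
        rw [← Real.rpow_two, ← Real.rpow_two, ← Real.rpow_mul hx.le, ← Real.rpow_add hx]
        exact Real.rpow_le_rpow_of_exponent_ge hx h (by linarith)
      refine (div_le_div_of_nonneg_right (seriesLoss_le_sq hx.le) (by norm_num)).trans ?_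
      rw [div_pow, mul_div_assoc', div_le_div_iff₀ (by norm_num) (by positivity)]
      have h3 : (x ^ k + x ^ p) ^ 2 ≤ (2 * x ^ p) ^ 2 := by gcongr; linarith
      calc x ^ 2 * (x ^ k + x ^ p) ^ 2 ≤ x ^ 2 * (2 * x ^ p) ^ 2 := by gcongr
        _ = 4 * x ^ p * (x ^ 2 * x ^ p) := by ring
        _ ≤ 4 * x ^ p * (x ^ k) ^ 2 := by gcongr
        _ = _ := by ring
  have key := lintegral_add_le_of_tangent hk hp (W := harmonicBarrier k p) (x := x)
    (α := x ^ k * (x ^ p / (x ^ k + x ^ p)) ^ 2) (β := x ^ p * (x ^ k / (x ^ k + x ^ p)) ^ 2)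
    (by positivity) (by positivity) (fun t ht => ?_) (le_of_eq ?_)
  · refine le_trans (add_le_add_right (ENNReal.ofReal_le_ofReal ?_) _) key
    calc _ = (1 - (weightMoment μ p).toReal) * (seriesLoss x / 4) := by ring
      _ ≤ _ := mul_le_mul_of_nonneg_left hloss (by linarith)
  · have htk : 0 < t ^ k := Real.rpow_pos_of_pos ht k
    have htp : 0 < t ^ p := Real.rpow_pos_of_pos ht p
    rw [harmonicBarrier, Real.mul_rpow hx.le ht.le, Real.mul_rpow hx.le ht.le]
    generalize x ^ k = a at *
    generalize x ^ p = b at *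
    generalize t ^ k = c at *
    generalize t ^ p = d at *
    rw [div_le_iff₀ (by positivity)]
    have : (a * (b / (a + b)) ^ 2 * c + b * (a / (a + b)) ^ 2 * d) * (a * c + b * d)
        - a * c * (b * d) = (a * c * (b / (a + b)) - b * d * (a / (a + b))) ^ 2 := by
      field_simp; ring
    nlinarith [sq_nonneg (a * c * (b / (a + b)) - b * d * (a / (a + b)))]
  · rw [harmonicBarrier]
    field_simp
    ring

/-- For k = 2 the condition 2k - 2 ≤ p < k of the harmonic barrier is void, and a logarithm must be
paid. The majorant comes from the tangent of r ↦ log(1 + r) at r = x^(p-2), multiplied by (xt)². -/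
theorem lintegral_logBarrier_le {μ : Measure WeightSeq} {p : ℝ} (h2 : weightMoment μ 2 = 1)
    (hp : weightMoment μ p < 1) (hp1 : 1 < p) (hp2 : p < 2) {x : ℝ} (hx : 0 < x) :
    ∫⁻ a, ∑ i ∈ Finset.range a.1, ENNReal.ofReal (logBarrier p (x * a.entry i)) ∂μ
      + ENNReal.ofReal ((1 - (weightMoment μ p).toReal) / 2 * seriesLoss x)
      ≤ ENNReal.ofReal (logBarrier p x) := by
  have hm1 : (weightMoment μ p).toReal ≤ 1 := by
    rw [← ENNReal.toReal_one]
    exact ENNReal.toReal_mono ENNReal.one_ne_top hp.le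
  have hr : 0 < x ^ (p - 2) := Real.rpow_pos_of_pos hx _
  have hloss : seriesLoss x / 2 ≤ x ^ 2 * (x ^ (p - 2) / (1 + x ^ (p - 2))) := by
    rcases le_total 1 x with h | h
    · have h1 : x ^ (p - 2) ≤ 1 := Real.rpow_le_one_of_one_le_of_nonpos h (by linarith)
      have h3 : x ≤ x ^ 2 * x ^ (p - 2) := by
        rw [← Real.rpow_two, ← Real.rpow_add hx]
        simpa using Real.rpow_le_rpow_of_exponent_le h (show 1 ≤ 2 + (p - 2) by linarith)
      rw [mul_div_assoc', div_le_div_iff₀ two_pos (by positivity)]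
      calc seriesLoss x * (1 + x ^ (p - 2)) ≤ x * (1 + 1) := by
            gcongr; exact seriesLoss_le hx.le
        _ ≤ _ := by linarith
    · have h1 : 1 ≤ x ^ (p - 2) := Real.one_le_rpow_of_pos_of_le_one_of_nonpos hx h (by linarith)
      have h3 : 1 / 2 ≤ x ^ (p - 2) / (1 + x ^ (p - 2)) := by
        rw [div_le_div_iff₀ two_pos (by positivity)]; linarith
      calc seriesLoss x / 2 ≤ x ^ 2 * (1 / 2) := by linarith [seriesLoss_le_sq hx.le]
        _ ≤ _ := by gcongr
  have hlog : x ^ (p - 2) / (1 + x ^ (p - 2)) ≤ Real.log (1 + x ^ (p - 2)) := by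
    have h := Real.one_sub_inv_le_log_of_pos (show 0 < 1 + x ^ (p - 2) by positivity)
    refine le_trans (le_of_eq ?_) h
    field_simp; ring
  have key := lintegral_add_le_of_tangent h2 hp (W := logBarrier p) (x := x)
    (α := x ^ 2 * (Real.log (1 + x ^ (p - 2)) - x ^ (p - 2) / (1 + x ^ (p - 2))))
    (β := x ^ 2 * (x ^ (p - 2) / (1 + x ^ (p - 2))))
    (mul_nonneg (sq_nonneg x) (sub_nonneg.2 hlog)) (by positivity) (fun t ht => ?_) (le_of_eq ?_)
  · refine le_trans (add_le_add_right (ENNReal.ofReal_le_ofReal ?_) _) key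
    calc _ = (1 - (weightMoment μ p).toReal) * (seriesLoss x / 2) := by ring
      _ ≤ _ := mul_le_mul_of_nonneg_left hloss (by linarith)
  · have htp : t ^ p = t ^ 2 * t ^ (p - 2) := by
      rw [← Real.rpow_two, ← Real.rpow_add ht]; congr 1; ring
    have hs : 0 < t ^ (p - 2) := Real.rpow_pos_of_pos ht _
    rw [logBarrier, Real.mul_rpow hx.le ht.le, htp, Real.rpow_two]
    generalize x ^ (p - 2) = r at *
    generalize t ^ (p - 2) = s at *
    have h := Real.log_le_sub_one_of_pos (show 0 < (1 + r * s) / (1 + r) by positivity)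
    rw [Real.log_div (by positivity) (by positivity)] at h
    have e1 : (1 + r * s) / (1 + r) - 1 = r / (1 + r) * s - r / (1 + r) := by
      field_simp; ring
    have : Real.log (1 + r * s) ≤ Real.log (1 + r) - r / (1 + r) + r / (1 + r) * s := by linarith
    calc (x * t) ^ 2 * Real.log (1 + r * s)
        ≤ (x * t) ^ 2 * (Real.log (1 + r) - r / (1 + r) + r / (1 + r) * s) := by gcongr
      _ = _ := by ring
  · rw [logBarrier]; ring

theorem measurable_harmonicBarrier (k p : ℝ) : Measurable (harmonicBarrier k p) := by
  unfold harmonicBarrier; fun_prop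

theorem harmonicBarrier_zero {k p : ℝ} (hk : 0 < k) : harmonicBarrier k p 0 = 0 := by
  simp [harmonicBarrier, Real.zero_rpow hk.ne']

theorem harmonicBarrier_le {k p x : ℝ} (hx : 0 ≤ x) : harmonicBarrier k p x ≤ x ^ k := by
  have ha : 0 ≤ x ^ k := Real.rpow_nonneg hx k
  have hb : 0 ≤ x ^ p := Real.rpow_nonneg hx p
  rw [harmonicBarrier, mul_div_assoc]
  exact mul_le_of_le_one_right ha (div_le_one_of_le₀ (by linarith) (by positivity))

section Recursion

variable {μ : Measure WeightSeq} [IsProbabilityMeasure μ]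

/-- The expected conductance decreases at most at the rate of its `k`-th power. -/
theorem exists_expectedConductance_sub_rpow_le {k : ℝ} (h1 : weightMoment μ 1 = 1)
    (hder : HDerivative μ) (hk1 : 1 < k) (hk2 : k < 2) (hk : weightMoment μ k = 1)
    (hint : ∫⁻ a, ENNReal.ofReal ((∑ i ∈ Finset.range a.1, a.entry i) ^ k) ∂μ < ⊤) :
    ∃ C : ℝ, 0 < C ∧ ∀ n, expectedConductance μ n - C * expectedConductance μ n ^ k
      ≤ expectedConductance μ (n + 1) := by
  obtain ⟨p, hp1, hpr, hpk, hp⟩ :=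
    exists_weightMoment_lt_one_near h1 hder hk1 hk (show 2 * k - 2 < k by linarith)
  have hm1 : (weightMoment μ p).toReal < 1 := by
    rw [← ENNReal.toReal_one]
    exact (ENNReal.toReal_lt_toReal hp.ne_top ENNReal.one_ne_top).2 hp
  have hd : 0 < (1 - (weightMoment μ p).toReal) / 4 := by linarith
  set d := (1 - (weightMoment μ p).toReal) / 4 with hd_def
  set B : ENNReal := ∫⁻ a, ENNReal.ofReal ((∑ i ∈ Finset.range a.1, a.entry i) ^ k) ∂μ
  have hS0 (a : WeightSeq) : 0 ≤ ∑ i ∈ Finset.range a.1, a.entry i :=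
    Finset.sum_nonneg fun i _ => entry_nonneg a i
  -- The source is E L(yS) with S = Σ A(i), and the linear operator commutes with scaling of y.
  -- Averaging the barrier over an independent copy of S therefore gives a supersolution for the
  -- averaged source, and only E S^k needs to be finite.
  let W : ℝ → ENNReal := fun y => ENNReal.ofReal d⁻¹ *
    ∫⁻ b, ENNReal.ofReal (harmonicBarrier k p (y * ∑ j ∈ Finset.range b.1, b.entry j)) ∂μ
  have hmeas (y : ℝ) : Measurable fun b : WeightSeq =>
      ENNReal.ofReal (harmonicBarrier k p (y * ∑ j ∈ Finset.range b.1, b.entry j)) :=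
    ((measurable_harmonicBarrier k p).comp (measurable_totalWeight.const_mul y)).ennreal_ofReal
  have hW : ∀ y, 0 < y → ∫⁻ a, ∑ i ∈ Finset.range a.1, W (y * a.entry i) ∂μ
      + ∫⁻ a, ENNReal.ofReal (seriesLoss (y * ∑ i ∈ Finset.range a.1, a.entry i)) ∂μ ≤ W y := by
    intro y hy
    have hjoint : Measurable (Function.uncurry fun b a : WeightSeq => ∑ i ∈ Finset.range a.1,
        ENNReal.ofReal (harmonicBarrier k p
          (y * (∑ j ∈ Finset.range b.1, b.entry j) * a.entry i))) := by
      refine measurable_sum_range (N := fun q : WeightSeq × WeightSeq => q.2.1)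
        (measurable_length.comp measurable_snd) fun i => ?_
      refine ((measurable_harmonicBarrier k p).comp ?_).ennreal_ofReal
      exact ((measurable_totalWeight.comp measurable_fst).const_mul y).mul
        ((measurable_entry i).comp measurable_snd)
    have hmloss : Measurable fun b : WeightSeq =>
        ENNReal.ofReal (seriesLoss (y * ∑ j ∈ Finset.range b.1, b.entry j)) :=
      (measurable_seriesLoss.comp (measurable_totalWeight.const_mul y)).ennreal_ofReal
    have hswap : ∫⁻ a, ∑ i ∈ Finset.range a.1, W (y * a.entry i) ∂μ
        = ENNReal.ofReal d⁻¹ * ∫⁻ b, ∫⁻ a, ∑ i ∈ Finset.range a.1,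
          ENNReal.ofReal (harmonicBarrier k p
            (y * (∑ j ∈ Finset.range b.1, b.entry j) * a.entry i)) ∂μ ∂μ := by
      rw [lintegral_lintegral_swap hjoint.aemeasurable,
        ← lintegral_const_mul _ hjoint.lintegral_prod_left]
      refine lintegral_congr fun a => ?_
      have hcomm (b : WeightSeq) (i : ℕ) : y * (∑ j ∈ Finset.range b.1, b.entry j) * a.entry i
          = y * a.entry i * ∑ j ∈ Finset.range b.1, b.entry j := mul_right_comm _ _ _
      simp only [hcomm]
      rw [lintegral_finsetSum _ fun i _ => hmeas (y * a.entry i), Finset.mul_sum]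
    have hloss : ∫⁻ a, ENNReal.ofReal (seriesLoss (y * ∑ i ∈ Finset.range a.1, a.entry i)) ∂μ
        = ENNReal.ofReal d⁻¹ * ∫⁻ b, ENNReal.ofReal
          (d * seriesLoss (y * ∑ j ∈ Finset.range b.1, b.entry j)) ∂μ := by
      simp only [ENNReal.ofReal_mul hd.le]
      rw [lintegral_const_mul _ hmloss, ← mul_assoc, ← ENNReal.ofReal_mul (inv_pos.2 hd).le,
        inv_mul_cancel₀ hd.ne', ENNReal.ofReal_one, one_mul]
    rw [hswap, hloss, ← mul_add]
    refine mul_le_mul_right ?_ _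
    rw [← lintegral_add_left hjoint.lintegral_prod_right]
    refine lintegral_mono fun b => ?_
    -- The sum vanishes when the sequence is empty; the barrier inequality is only available at
    -- positive arguments.
    rcases (hS0 b).eq_or_lt with h | h
    · simp [← h, harmonicBarrier_zero (show 0 < k by linarith), seriesLoss]
    · exact lintegral_harmonicBarrier_le hk hp hp1 hpk hpr (mul_pos hy h)
  -- The added 1 only makes the constant visibly positive.
  refine ⟨d⁻¹ * (B.toReal + 1), mul_pos (inv_pos.2 hd)
    (add_pos_of_nonneg_of_pos ENNReal.toReal_nonneg one_pos), ?_⟩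
  refine le_expectedConductance_succ (by rw [← weightMoment_one, h1]) hW
    (w := fun y => d⁻¹ * (B.toReal + 1) * y ^ k) (fun y hy => ?_) fun y hy => ?_
  · have := Real.rpow_nonneg hy.le k
    have := ENNReal.toReal_nonneg (a := B)
    positivity
  · have hyk := Real.rpow_nonneg hy.le k
    calc W y ≤ ENNReal.ofReal d⁻¹ * (ENNReal.ofReal (y ^ k) * B) := by
          refine mul_le_mul_right ?_ _
          rw [← lintegral_const_mul' _ _ ENNReal.ofReal_ne_top]
          refine lintegral_mono fun b => ?_
          rw [← ENNReal.ofReal_mul hyk, ← Real.mul_rpow hy.le (hS0 b)]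
          exact ENNReal.ofReal_le_ofReal (harmonicBarrier_le (mul_nonneg hy.le (hS0 b)))
      _ = ENNReal.ofReal (d⁻¹ * B.toReal * y ^ k) := by
          rw [mul_assoc d⁻¹, ENNReal.ofReal_mul (inv_pos.2 hd).le,
            ENNReal.ofReal_mul ENNReal.toReal_nonneg, ENNReal.ofReal_toReal hint.ne, mul_comm B]
      _ ≤ _ := by
          refine ENNReal.ofReal_le_ofReal ?_
          gcongr
          linarith

/-- With a finite second moment this bounds the source E L(yS) by a multiple of L(y), so in the
critical case the barrier need not be averaged over S. -/
theorem seriesLoss_mul_le {y c : ℝ} (hy : 0 ≤ y) (hc : 0 ≤ c) :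
    seriesLoss (y * c) ≤ (1 + c ^ 2) * seriesLoss y := by
  unfold seriesLoss
  rw [mul_div_assoc', div_le_div_iff₀ (by positivity) (by positivity)]
  have : 0 ≤ y ^ 2 * (1 + y * (c * (c ^ 2 - c + 1))) := by
    have : 0 ≤ c ^ 2 - c + 1 := by nlinarith [sq_nonneg (c - 1)]
    positivity
  nlinarith

/-- The critical case of `exists_expectedConductance_sub_rpow_le`. -/
theorem exists_expectedConductance_sub_sq_mul_log_le (h1 : weightMoment μ 1 = 1)
    (hder : HDerivative μ) (h2 : weightMoment μ 2 = 1)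
    (hint : ∫⁻ a, ENNReal.ofReal ((∑ i ∈ Finset.range a.1, a.entry i) ^ 2) ∂μ < ⊤) :
    ∃ C : ℝ, 0 < C ∧ ∀ n, expectedConductance μ n
        - C * (expectedConductance μ n ^ 2 * Real.log (1 + (expectedConductance μ n)⁻¹))
      ≤ expectedConductance μ (n + 1) := by
  obtain ⟨p, hp1, -, hp2, hp⟩ := exists_weightMoment_lt_one_near h1 hder one_lt_two h2 one_lt_two
  have hm1 : (weightMoment μ p).toReal < 1 := by
    rw [← ENNReal.toReal_one]
    exact (ENNReal.toReal_lt_toReal hp.ne_top ENNReal.one_ne_top).2 hp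
  have hd : 0 < (1 - (weightMoment μ p).toReal) / 2 := by linarith
  set d := (1 - (weightMoment μ p).toReal) / 2 with hd_def
  set B : ENNReal := ∫⁻ a, ENNReal.ofReal ((∑ i ∈ Finset.range a.1, a.entry i) ^ 2) ∂μ
  have hB0 : 0 ≤ B.toReal := ENNReal.toReal_nonneg
  have hS0 (a : WeightSeq) : 0 ≤ ∑ i ∈ Finset.range a.1, a.entry i :=
    Finset.sum_nonneg fun i _ => entry_nonneg a i
  have hc0 : 0 ≤ d⁻¹ * (1 + B.toReal) := by positivity
  have hH {y : ℝ} (hy : 0 < y) :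
      ∫⁻ a, ENNReal.ofReal (seriesLoss (y * ∑ i ∈ Finset.range a.1, a.entry i)) ∂μ
        ≤ ENNReal.ofReal ((1 + B.toReal) * seriesLoss y) := by
    have hl := seriesLoss_nonneg hy.le
    calc _ ≤ ∫⁻ a, (1 + ENNReal.ofReal ((∑ i ∈ Finset.range a.1, a.entry i) ^ 2))
          * ENNReal.ofReal (seriesLoss y) ∂μ := by
          refine lintegral_mono fun a => ?_
          rw [← ENNReal.ofReal_one, ← ENNReal.ofReal_add zero_le_one (sq_nonneg _),
            ← ENNReal.ofReal_mul (by positivity)]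
          exact ENNReal.ofReal_le_ofReal (seriesLoss_mul_le hy.le (hS0 a))
      _ = (1 + B) * ENNReal.ofReal (seriesLoss y) := by
          rw [lintegral_mul_const' _ _ ENNReal.ofReal_ne_top, lintegral_add_left measurable_const]
          simp [B]
      _ = _ := by
          rw [ENNReal.ofReal_mul (by positivity), ENNReal.ofReal_add zero_le_one hB0,
            ENNReal.ofReal_toReal hint.ne, ENNReal.ofReal_one]
  refine ⟨d⁻¹ * (1 + B.toReal), by positivity, fun n => ?_⟩
  have hmass : ∫⁻ a, ENNReal.ofReal (∑ i ∈ Finset.range a.1, a.entry i) ∂μ = 1 := by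
    rw [← weightMoment_one, h1]
  have hstep := le_expectedConductance_succ hmass
    (W := fun y => ENNReal.ofReal (d⁻¹ * (1 + B.toReal)) * ENNReal.ofReal (logBarrier p y))
    (fun y hy => ?_) (w := fun y => d⁻¹ * (1 + B.toReal) * logBarrier p y) (fun y hy => ?_)
    (fun y hy => (ENNReal.ofReal_mul hc0).ge) n
  · refine le_trans (sub_le_sub_left (mul_le_mul_of_nonneg_left ?_ hc0) _) hstep
    have hx := expectedConductance_pos hmass n
    have hx1 : expectedConductance μ n ≤ 1 := by
      rw [← expectedConductance_zero hmass]
      exact antitone_nat_of_succ_le (expectedConductance_succ_le hmass) (Nat.zero_le n)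
    unfold logBarrier
    gcongr
    -- The exponent p - 2 exceeds -1 and the expected conductance is at most 1, so its power is at
    -- most its inverse.
    rw [← Real.rpow_neg_one]
    exact Real.rpow_le_rpow_of_exponent_ge hx hx1 (by linarith)
  · have hb := lintegral_logBarrier_le h2 hp hp1 hp2 hy
    refine le_trans ?_ (mul_le_mul_right hb _)
    simp only [← Finset.mul_sum]
    rw [lintegral_const_mul' _ _ ENNReal.ofReal_ne_top, mul_add (ENNReal.ofReal _),
      ← ENNReal.ofReal_mul hc0]
    refine add_le_add_right ((hH hy).trans (le_of_eq ?_)) _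
    rw [← hd_def]
    congr 1
    field_simp
  · have := Real.rpow_nonneg hy.le (p - 2)
    exact mul_nonneg hc0 (mul_nonneg (sq_nonneg y) (Real.log_nonneg (by linarith)))

end Recursion

/-! ### Real recursions -/

/-- Discrete form of the equation x' = -C x^k: the quantity x^(-(k-1)) grows at most linearly. -/
theorem exists_le_rpow_mul_of_recursion {x : ℕ → ℝ} {C k : ℝ} (hx : ∀ n, 0 < x n)
    (hanti : Antitone x) (hC : 0 < C) (hk1 : 1 < k) (hk2 : k < 2)
    (hrec : ∀ n, x n - C * x n ^ k ≤ x (n + 1)) :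
    ∃ c, 0 < c ∧ ∀ᶠ n : ℕ in atTop, c ≤ (n : ℝ) ^ (1 / (k - 1)) * x n := by
  have hγ : 0 < k - 1 := by linarith
  have hv (n) : 0 < x n ^ (k - 1) := Real.rpow_pos_of_pos (hx n) _
  have hroot (n) : (x n ^ (k - 1)) ^ (1 / (k - 1)) = x n := by
    rw [← Real.rpow_mul (hx n).le, mul_one_div_cancel hγ.ne', Real.rpow_one]
  suffices h : ∃ c, 0 < c ∧ ∀ᶠ n : ℕ in atTop, c ≤ (n : ℝ) * x n ^ (k - 1) by
    obtain ⟨c, hc, h⟩ := h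
    refine ⟨c ^ (1 / (k - 1)), Real.rpow_pos_of_pos hc _, h.mono fun n hn => ?_⟩
    have h2 := Real.rpow_le_rpow hc.le hn (one_div_pos.2 hγ).le
    rwa [Real.mul_rpow n.cast_nonneg (hv n).le, hroot] at h2
  -- Either the sequence becomes small, and stays so by monotonicity, which allows 1/(1-z) ≤ 1 + 2z;
  -- or it is bounded below and the claim is immediate.
  by_cases hN : ∃ N, C * x N ^ (k - 1) ≤ 1 / 2
  · obtain ⟨N, hN⟩ := hN
    have hsmall (m) : C * x (N + m) ^ (k - 1) ≤ 1 / 2 := by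
      refine le_trans ?_ hN
      have := Real.rpow_le_rpow (hx _).le (hanti (Nat.le_add_right N m)) hγ.le
      gcongr
    have hstep (m) : (x (N + (m + 1)) ^ (k - 1))⁻¹ ≤ (x (N + m) ^ (k - 1))⁻¹ + 2 * C := by
      have h1 : x (N + m) * (1 - C * x (N + m) ^ (k - 1)) ≤ x (N + (m + 1)) := by
        refine le_trans (le_of_eq ?_) (hrec (N + m))
        have : x (N + m) ^ k = x (N + m) * x (N + m) ^ (k - 1) := by
          rw [← Real.rpow_one_add' (hx _).le (by linarith)]; congr 1; ring
        rw [this]; ring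
      have hs := hsmall m
      set z := C * x (N + m) ^ (k - 1) with hz
      have hz0 : 0 < z := mul_pos hC (hv _)
      have h2 : x (N + m) ^ (k - 1) * (1 - z) ≤ x (N + (m + 1)) ^ (k - 1) := by
        refine le_trans ?_ (Real.rpow_le_rpow (mul_nonneg (hx _).le (by linarith)) h1 hγ.le)
        rw [Real.mul_rpow (hx _).le (by linarith)]
        refine mul_le_mul_of_nonneg_left ?_ (hv _).le
        -- Here k < 2 enters: the base lies in [0, 1] and the exponent k - 1 is at most 1.
        calc 1 - z = (1 - z) ^ (1 : ℝ) := (Real.rpow_one _).symm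
          _ ≤ _ := Real.rpow_le_rpow_of_exponent_ge (by linarith) (by linarith) (by linarith)
      have h3 : (x (N + (m + 1)) ^ (k - 1))⁻¹ ≤ (x (N + m) ^ (k - 1) * (1 - z))⁻¹ :=
        inv_anti₀ (mul_pos (hv _) (by linarith)) h2
      refine h3.trans ?_
      have hv' := hv (N + m)
      rw [show (x (N + m) ^ (k - 1))⁻¹ + 2 * C = (1 + 2 * z) / x (N + m) ^ (k - 1) by
        rw [hz]; field_simp, inv_eq_one_div, div_le_div_iff₀ (mul_pos hv' (by linarith)) hv']
      nlinarith [mul_nonneg hv'.le (mul_nonneg hz0.le (show 0 ≤ 1 - 2 * z by linarith))]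
    have hlin (m : ℕ) : (x (N + m) ^ (k - 1))⁻¹ ≤ (x N ^ (k - 1))⁻¹ + 2 * C * m := by
      induction m with
      | zero => simp
      | succ m ih => push_cast; linarith [hstep m]
    have hK : 0 < (x N ^ (k - 1))⁻¹ + 2 * C := add_pos (inv_pos.2 (hv N)) (by linarith)
    refine ⟨((x N ^ (k - 1))⁻¹ + 2 * C)⁻¹, inv_pos.2 hK, ?_⟩
    filter_upwards [eventually_ge_atTop (N + 1)] with n hn
    obtain ⟨m, rfl⟩ := Nat.exists_eq_add_of_le (show N ≤ n by omega)
    have h1 : (1 : ℝ) ≤ ((N + m : ℕ) : ℝ) := by exact_mod_cast (show 1 ≤ N + m by omega)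
    have h2 : (m : ℝ) ≤ ((N + m : ℕ) : ℝ) := by exact_mod_cast Nat.le_add_left m N
    have h3 : (x (N + m) ^ (k - 1))⁻¹ ≤ ((x N ^ (k - 1))⁻¹ + 2 * C) * ((N + m : ℕ) : ℝ) := by
      refine (hlin m).trans ?_
      have := inv_pos.2 (hv N)
      rw [add_mul]
      gcongr
      exact le_mul_of_one_le_right this.le h1
    rw [inv_le_iff_one_le_mul₀ hK]
    rw [inv_le_iff_one_le_mul₀ (hv _)] at h3
    linarith
  · push Not at hN
    refine ⟨1 / (2 * C), by positivity, ?_⟩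
    filter_upwards [eventually_ge_atTop 1] with n hn
    have h1 : (1 : ℝ) ≤ n := by exact_mod_cast hn
    have h2 : 1 / (2 * C) ≤ x n ^ (k - 1) := by
      rw [div_le_iff₀ (by positivity)]; linarith [hN n]
    exact h2.trans (le_mul_of_one_le_left (hv n).le h1)

/-- Once x is small, u = 1/x increases by at most 2C log(1 + u) per step, so u ≤ B n log n follows
by induction for B large. -/
theorem exists_le_mul_log_mul_of_recursion {x : ℕ → ℝ} {C : ℝ} (hx : ∀ n, 0 < x n)
    (hanti : Antitone x) (hC : 0 < C)
    (hrec : ∀ n, x n - C * (x n ^ 2 * Real.log (1 + (x n)⁻¹)) ≤ x (n + 1)) :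
    ∃ c, 0 < c ∧ ∀ᶠ n : ℕ in atTop, c ≤ (n : ℝ) * Real.log n * x n := by
  have hloglin {ε : ℝ} (hε : 0 < ε) : ∀ᶠ u : ℝ in atTop, Real.log u ≤ ε * u := by
    filter_upwards [Real.isLittleO_log_id_atTop.bound hε, eventually_ge_atTop 1] with u hu h1
    rw [Real.norm_of_nonneg (Real.log_nonneg h1), id, Real.norm_of_nonneg (by linarith)] at hu
    exact hu
  have hlog3 {n : ℕ} (hn : 3 ≤ n) : 1 ≤ Real.log n := by
    rw [Real.le_log_iff_exp_le (by positivity)]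
    have : (3 : ℝ) ≤ n := by exact_mod_cast hn
    linarith [Real.exp_one_lt_d9]
  -- Beyond U, and since 1 + 1/x ≤ 2/x, the relative loss C x log(1 + 1/x) is at most 1/2.
  obtain ⟨U, hU⟩ := eventually_atTop.1 (hloglin (show 0 < 1 / (4 * C) by positivity))
  by_cases hN : ∃ N, max U 1 ≤ (x N)⁻¹
  · obtain ⟨N, hN⟩ := hN
    have hbig (n) (hn : N ≤ n) : max U 1 ≤ (x n)⁻¹ :=
      hN.trans (inv_anti₀ (hx n) (hanti hn))
    have hstep (n) (hn : N ≤ n) :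
        (x (n + 1))⁻¹ ≤ (x n)⁻¹ + 2 * C * Real.log (1 + (x n)⁻¹) := by
      have hxn := hx n
      have hb := hbig n hn
      have h1 : 1 ≤ (x n)⁻¹ := (le_max_right _ _).trans hb
      have hl := hU (1 + (x n)⁻¹) (by linarith [le_max_left U 1])
      have hL : 0 ≤ Real.log (1 + (x n)⁻¹) := Real.log_nonneg (by linarith)
      have hr := hrec n
      set L := Real.log (1 + (x n)⁻¹)
      have hz : C * (x n * L) ≤ 1 / 2 := by
        have h2 : L ≤ 1 / (4 * C) * (2 * (x n)⁻¹) := by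
          refine hl.trans ?_
          gcongr
          linarith
        calc C * (x n * L) ≤ C * (x n * (1 / (4 * C) * (2 * (x n)⁻¹))) := by gcongr
          _ = 1 / 2 := by field_simp; norm_num
      have hz0 : 0 ≤ C * (x n * L) := by positivity
      have h3 : x n * (1 - C * (x n * L)) ≤ x (n + 1) := by
        refine le_trans (le_of_eq ?_) hr; ring
      refine (inv_anti₀ (mul_pos hxn (by linarith)) h3).trans ?_
      rw [show (x n)⁻¹ + 2 * C * L = (1 + 2 * (C * (x n * L))) / x n by field_simp,
        inv_eq_one_div, div_le_div_iff₀ (mul_pos hxn (by linarith)) hxn]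
      generalize C * (x n * L) = z at *
      nlinarith [mul_nonneg hxn.le (mul_nonneg hz0 (show 0 ≤ 1 - 2 * z by linarith))]
    set N₁ := max N 3
    -- The last condition closes the induction: under the hypothesis at n the increment is at most
    -- 2C(3 + log B) log n, which B log n absorbs. It can be met because log B is sublinear.
    obtain ⟨B, hB1, hBx, hBlog⟩ : ∃ B : ℝ, 1 ≤ B ∧ (x N₁)⁻¹ ≤ B ∧
        2 * C * (3 + Real.log B) ≤ B := by
      obtain ⟨B, ⟨h1, h2⟩, h3, h4⟩ := (((eventually_ge_atTop (1 : ℝ)).and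
        (eventually_ge_atTop (x N₁)⁻¹)).and ((hloglin (show 0 < 1 / (4 * C) by positivity)).and
          (eventually_ge_atTop (12 * C)))).exists
      refine ⟨B, h1, h2, ?_⟩
      have : 2 * C * Real.log B ≤ 2 * C * (1 / (4 * C) * B) := by gcongr
      have h5 : 2 * C * (1 / (4 * C) * B) = B / 2 := by field_simp; norm_num
      linarith
    have hmain (n) (hn : N₁ ≤ n) : (x n)⁻¹ ≤ B * (n * Real.log n) := by
      induction n, hn using Nat.le_induction with
      | base =>
        have h3 : (3 : ℝ) ≤ N₁ := by exact_mod_cast le_max_right N 3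
        have hl := hlog3 (le_max_right N 3)
        refine hBx.trans (le_mul_of_one_le_right (by linarith) ?_)
        nlinarith
      | succ n hn ih =>
        have hn3 : 3 ≤ n := (le_max_right N 3).trans hn
        have h3 : (3 : ℝ) ≤ n := by exact_mod_cast hn3
        have hl := hlog3 hn3
        have hs := hstep n ((le_max_left N 3).trans hn)
        have hln : Real.log n ≤ n := (Real.log_le_self (by linarith))
        have hb : Real.log (1 + (x n)⁻¹) ≤ (3 + Real.log B) * Real.log n := by
          have h4 : 1 + (x n)⁻¹ ≤ 2 * B * n ^ 2 := by
            have : B * (n * Real.log n) ≤ B * n ^ 2 := by rw [sq]; gcongr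
            have : 1 ≤ B * (n : ℝ) ^ 2 := by
              nlinarith [mul_le_mul hB1 (show (1 : ℝ) ≤ (n : ℝ) ^ 2 by nlinarith) zero_le_one
                (by linarith)]
            linarith
          have h5 : 0 < 1 + (x n)⁻¹ := by have := inv_pos.2 (hx n); linarith
          refine (Real.log_le_log h5 h4).trans ?_
          rw [Real.log_mul (by positivity) (by positivity), Real.log_mul (by norm_num)
            (by positivity), Real.log_pow]
          have h6 : Real.log 2 ≤ 1 := by linarith [Real.log_two_lt_d9]
          have h7 : 0 ≤ Real.log B := Real.log_nonneg hB1
          push_cast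
          nlinarith [mul_nonneg h7 (sub_nonneg.2 hl)]
        have hmono : Real.log n ≤ Real.log (n + 1) := Real.log_le_log (by linarith) (by linarith)
        push_cast
        calc (x (n + 1))⁻¹ ≤ B * (n * Real.log n) + 2 * C * ((3 + Real.log B) * Real.log n) := by
              refine hs.trans (add_le_add ih ?_)
              gcongr
          _ = B * (n * Real.log n) + (2 * C * (3 + Real.log B)) * Real.log n := by ring
          _ ≤ B * (n * Real.log n) + B * Real.log n := by gcongr
          _ = B * ((n + 1) * Real.log n) := by ring
          _ ≤ _ := by gcongr
    refine ⟨B⁻¹, by positivity, ?_⟩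
    filter_upwards [eventually_ge_atTop N₁] with n hn
    have h := hmain n hn
    have hB : 0 < B := by linarith
    rw [inv_le_iff_one_le_mul₀ (hx n)] at h
    rw [inv_le_iff_one_le_mul₀ hB]
    linarith
  · push Not at hN
    have hU0 : 0 < max U 1 := lt_max_of_lt_right one_pos
    refine ⟨(max U 1)⁻¹, inv_pos.2 hU0, ?_⟩
    filter_upwards [eventually_ge_atTop 3] with n hn
    have h3 : (3 : ℝ) ≤ n := by exact_mod_cast hn
    have hl := hlog3 hn
    have h1 : (max U 1)⁻¹ ≤ x n := inv_le_of_inv_le₀ (hx n) (hN n).le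
    exact h1.trans (le_mul_of_one_le_left (hx n).le (by nlinarith))

/-! ### Square-integrable case -/

theorem eLpNorm_two_eq_ofReal_sqrt {Ω : Type*} [MeasurableSpace Ω] {P : Measure Ω} {f : Ω → ℝ}
    (hf : MemLp f 2 P) : eLpNorm f 2 P = ENNReal.ofReal √(∫ ω, f ω ^ 2 ∂P) := by
  rw [hf.eLpNorm_eq_integral_rpow_norm two_ne_zero ENNReal.ofNat_ne_top, Real.sqrt_eq_rpow]
  simp

section SquareIntegrable

variable {μ : Measure WeightSeq} [IsProbabilityMeasure μ]

theorem memLp_branchSum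
    (hint : ∫⁻ a, ENNReal.ofReal ((∑ i ∈ Finset.range a.1, a.entry i) ^ 2) ∂μ < ⊤)
    {F : WeightedTree → ℝ} (hm : Measurable F) (hF : MemLp F 2 (treeLaw μ)) :
    MemLp (branchSum F) 2 (treeLaw μ) := by
  rw [memLp_two_iff_integrable_sq (measurable_branchSum hm).aestronglyMeasurable,
    ← lintegral_ofReal_ne_top_iff_integrable
      ((measurable_branchSum hm).pow_const 2).aestronglyMeasurable
      (ae_of_all _ fun _ => sq_nonneg _), lintegral_sq_branchSum μ hm hF]
  refine ENNReal.add_ne_top.2 ⟨ENNReal.mul_ne_top (ne_top_of_le_ne_top hint.ne ?_)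
    ENNReal.ofReal_ne_top, ENNReal.mul_ne_top (ne_top_of_le_ne_top hint.ne ?_)
    ENNReal.ofReal_ne_top⟩
  · exact lintegral_mono fun a => ENNReal.ofReal_le_ofReal
      (Finset.sum_sq_le_sq_sum_of_nonneg fun i _ => entry_nonneg a i)
  · exact lintegral_mono fun a => ENNReal.ofReal_le_ofReal
      (sub_le_self _ (Finset.sum_nonneg fun i _ => sq_nonneg _))

/-- The off-diagonal part of `E[(∑ A(i))²]`. -/
noncomputable def crossMoment (μ : Measure WeightSeq) : ℝ :=
  (∫⁻ a, ENNReal.ofReal ((∑ i ∈ Finset.range a.1, a.entry i) ^ 2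
    - ∑ i ∈ Finset.range a.1, a.entry i ^ 2) ∂μ).toReal

theorem integral_sq_branchSum
    (hint : ∫⁻ a, ENNReal.ofReal ((∑ i ∈ Finset.range a.1, a.entry i) ^ 2) ∂μ < ⊤)
    {F : WeightedTree → ℝ} (hm : Measurable F) (hF : MemLp F 2 (treeLaw μ)) :
    ∫ t, branchSum F t ^ 2 ∂(treeLaw μ)
      = (weightMoment μ 2).toReal * ∫ t, F t ^ 2 ∂(treeLaw μ)
        + crossMoment μ * (∫ t, F t ∂(treeLaw μ)) ^ 2 := by
  have h := lintegral_sq_branchSum μ hm hF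
  have hm2 : (∫⁻ a, ENNReal.ofReal (∑ i ∈ Finset.range a.1, a.entry i ^ 2) ∂μ) = weightMoment μ 2 := by
    simp [weightMoment]
  have hf : ∫⁻ a, ENNReal.ofReal ((∑ i ∈ Finset.range a.1, a.entry i) ^ 2
      - ∑ i ∈ Finset.range a.1, a.entry i ^ 2) ∂μ ≠ ⊤ :=
    ne_top_of_le_ne_top hint.ne (lintegral_mono fun a => ENNReal.ofReal_le_ofReal
      (sub_le_self _ (Finset.sum_nonneg fun i _ => sq_nonneg _)))
  rw [hm2] at h
  rw [integral_eq_lintegral_of_nonneg_ae (ae_of_all _ fun _ => sq_nonneg _)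
    ((measurable_branchSum hm).pow_const 2).aestronglyMeasurable, h,
    ENNReal.toReal_add (ENNReal.mul_ne_top
      (ne_top_of_le_ne_top hint.ne (weightMoment_two_le μ)) ENNReal.ofReal_ne_top)
      (ENNReal.mul_ne_top hf ENNReal.ofReal_ne_top), ENNReal.toReal_mul, ENNReal.toReal_mul,
    ENNReal.toReal_ofReal (integral_nonneg fun _ => sq_nonneg _),
    ENNReal.toReal_ofReal (sq_nonneg _), crossMoment]

theorem memLp_branchMartingale
    (hint : ∫⁻ a, ENNReal.ofReal ((∑ i ∈ Finset.range a.1, a.entry i) ^ 2) ∂μ < ⊤) (n : ℕ) :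
    MemLp (branchMartingale n) 2 (treeLaw μ) := by
  induction n with
  | zero => exact memLp_const 1
  | succ n ih => exact memLp_branchSum hint (measurable_branchMartingale n) ih

theorem branchMartingale_nonneg (n : ℕ) (t : WeightedTree) : 0 ≤ branchMartingale n t := by
  induction n generalizing t with
  | zero => exact zero_le_one
  | succ n ih => exact branchSum_nonneg ih t

theorem integral_branchMartingale
    (hmass : ∫⁻ a, ENNReal.ofReal (∑ i ∈ Finset.range a.1, a.entry i) ∂μ = 1) (n : ℕ) :
    ∫ t, branchMartingale n t ∂(treeLaw μ) = 1 := by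
  induction n with
  | zero => simp [branchMartingale]
  | succ n ih =>
    rw [← ih]
    exact integral_branchSum hmass (measurable_branchMartingale n) (branchMartingale_nonneg n)

theorem branchSum_sub (F G : WeightedTree → ℝ) :
    branchSum F - branchSum G = branchSum (F - G) := by
  ext t
  simp only [branchSum, Pi.sub_apply, mul_sub, Finset.sum_sub_distrib]

theorem integral_sq_branchMartingale_succ
    (hmass : ∫⁻ a, ENNReal.ofReal (∑ i ∈ Finset.range a.1, a.entry i) ∂μ = 1)
    (hint : ∫⁻ a, ENNReal.ofReal ((∑ i ∈ Finset.range a.1, a.entry i) ^ 2) ∂μ < ⊤) (n : ℕ) :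
    ∫ t, branchMartingale (n + 1) t ^ 2 ∂(treeLaw μ)
      = (weightMoment μ 2).toReal * ∫ t, branchMartingale n t ^ 2 ∂(treeLaw μ) + crossMoment μ := by
  rw [branchMartingale, integral_sq_branchSum hint (measurable_branchMartingale n)
    (memLp_branchMartingale hint n), integral_branchMartingale hmass]
  ring

/-- The second moments follow an affine recursion with nonnegative slope, so they increase as soon
as the first step does; that step is the nonnegativity of a variance. -/
theorem integral_sq_branchMartingale_mono
    (hmass : ∫⁻ a, ENNReal.ofReal (∑ i ∈ Finset.range a.1, a.entry i) ∂μ = 1)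
    (hint : ∫⁻ a, ENNReal.ofReal ((∑ i ∈ Finset.range a.1, a.entry i) ^ 2) ∂μ < ⊤) :
    Monotone fun n => ∫ t, branchMartingale n t ^ 2 ∂(treeLaw μ) := by
  refine monotone_nat_of_le_succ fun n => ?_
  induction n with
  | zero =>
    have hL := memLp_branchMartingale hint 1
    have hi : Integrable (branchMartingale 1) (treeLaw μ) := hL.integrable one_le_two
    have h : 0 ≤ ∫ t, (branchMartingale 1 t - 1) ^ 2 ∂(treeLaw μ) :=
      integral_nonneg fun _ => sq_nonneg _
    have he : ∫ t, (branchMartingale 1 t - 1) ^ 2 ∂(treeLaw μ)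
        = ∫ t, (branchMartingale 1 t ^ 2 - (2 * branchMartingale 1 t - 1)) ∂(treeLaw μ) :=
      integral_congr_ae (ae_of_all _ fun t => by ring)
    have hi1 : Integrable (fun t => 2 * branchMartingale 1 t - 1) (treeLaw μ) :=
      (hi.const_mul 2).sub (integrable_const 1)
    rw [he, integral_sub hL.integrable_sq hi1,
      integral_sub (hi.const_mul 2) (integrable_const 1), integral_const_mul,
      integral_branchMartingale hmass] at h
    simp only [integral_const, probReal_univ, smul_eq_mul] at h
    simp only [branchMartingale, one_pow, integral_const, probReal_univ, smul_eq_mul] at h ⊢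
    linarith
  | succ n ih =>
    rw [integral_sq_branchMartingale_succ hmass hint n,
      integral_sq_branchMartingale_succ hmass hint (n + 1)]
    have := mul_le_mul_of_nonneg_left ih (ENNReal.toReal_nonneg (a := weightMoment μ 2))
    linarith

/-- An increment of the martingale is the branching sum of the previous increment on the subtrees.
These have mean zero, so only the diagonal terms survive. -/
theorem integral_sq_branchMartingale_sub
    (hmass : ∫⁻ a, ENNReal.ofReal (∑ i ∈ Finset.range a.1, a.entry i) ∂μ = 1)
    (hint : ∫⁻ a, ENNReal.ofReal ((∑ i ∈ Finset.range a.1, a.entry i) ^ 2) ∂μ < ⊤) (n : ℕ) :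
    ∫ t, (branchMartingale (n + 1) - branchMartingale n) t ^ 2 ∂(treeLaw μ)
      = (weightMoment μ 2).toReal ^ n
        * ∫ t, (branchMartingale 1 - branchMartingale 0) t ^ 2 ∂(treeLaw μ) := by
  induction n with
  | zero => simp
  | succ n ih =>
    have hL := memLp_branchMartingale hint
    have h0 : ∫ t, (branchMartingale (n + 1) - branchMartingale n) t ∂(treeLaw μ) = 0 := by
      simp only [Pi.sub_apply]
      rw [integral_sub ((hL _).integrable one_le_two) ((hL _).integrable one_le_two),
        integral_branchMartingale hmass, integral_branchMartingale hmass, sub_self]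
    have hb : branchMartingale (n + 1 + 1) - branchMartingale (n + 1)
        = branchSum (branchMartingale (n + 1) - branchMartingale n) := branchSum_sub _ _
    rw [hb, integral_sq_branchSum hint
      ((measurable_branchMartingale _).sub (measurable_branchMartingale _)) ((hL _).sub (hL _)),
      h0, ih]
    ring

theorem exists_eLpNorm_branchMartingale_sub_lt
    (hmass : ∫⁻ a, ENNReal.ofReal (∑ i ∈ Finset.range a.1, a.entry i) ∂μ = 1)
    (hint : ∫⁻ a, ENNReal.ofReal ((∑ i ∈ Finset.range a.1, a.entry i) ^ 2) ∂μ < ⊤)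
    (h2 : weightMoment μ 2 < 1) : ∃ B : ℕ → ENNReal, ∑' n, B n ≠ ⊤ ∧ ∀ N n m : ℕ, N ≤ n → N ≤ m →
      eLpNorm (branchMartingale n - branchMartingale m) 2 (treeLaw μ) < B N := by
  have hm1 : (weightMoment μ 2).toReal < 1 := by
    rw [← ENNReal.toReal_one]
    exact (ENNReal.toReal_lt_toReal h2.ne_top ENNReal.one_ne_top).2 h2
  have hL := memLp_branchMartingale hint
  have hmm := measurable_branchMartingale
  -- The floor 1/2 ensures a positive ratio without a separate argument.
  obtain ⟨r, hr0, hr1, hr⟩ : ∃ r : ℝ, 0 < r ∧ r < 1 ∧ √(weightMoment μ 2).toReal ≤ r :=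
    ⟨max √(weightMoment μ 2).toReal (1 / 2), lt_max_of_lt_right (by norm_num),
      max_lt (by rw [Real.sqrt_lt' one_pos]; simpa using hm1) (by norm_num), le_max_left _ _⟩
  set K := √(∫ t, (branchMartingale 1 - branchMartingale 0) t ^ 2 ∂(treeLaw μ)) with hK
  have hK0 : 0 ≤ K := Real.sqrt_nonneg _
  have h1r : 0 < 1 - r := by linarith
  have hstep (n) : eLpNorm (branchMartingale (n + 1) - branchMartingale n) 2 (treeLaw μ)
      ≤ ENNReal.ofReal (K * r ^ n) := by
    rw [eLpNorm_two_eq_ofReal_sqrt ((hL _).sub (hL _)),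
      integral_sq_branchMartingale_sub hmass hint, Real.sqrt_mul (by positivity), mul_comm, ← hK]
    refine ENNReal.ofReal_le_ofReal (mul_le_mul_of_nonneg_left ?_ hK0)
    rw [Real.sqrt_le_left (by positivity), ← pow_mul, mul_comm n 2, pow_mul]
    exact pow_le_pow_left₀ ENNReal.toReal_nonneg (Real.sqrt_le_left hr0.le |>.1 hr) n
  have hsum (N j) : eLpNorm (branchMartingale (N + j) - branchMartingale N) 2 (treeLaw μ)
      ≤ ENNReal.ofReal (K * r ^ N * (1 - r ^ j) / (1 - r)) := by
    induction j with
    | zero => simp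
    | succ j ih =>
      have e : branchMartingale (N + (j + 1)) - branchMartingale N
          = (branchMartingale (N + j + 1) - branchMartingale (N + j))
            + (branchMartingale (N + j) - branchMartingale N) := by
        rw [← add_assoc]; abel
      rw [e]
      refine (eLpNorm_add_le ((hmm _).sub (hmm _)).aestronglyMeasurable
        ((hmm _).sub (hmm _)).aestronglyMeasurable one_le_two).trans
        ((add_le_add (hstep _) ih).trans ?_)
      have hrj : r ^ j ≤ 1 := pow_le_one₀ hr0.le hr1.le
      rw [← ENNReal.ofReal_add (by positivity)
        (div_nonneg (mul_nonneg (by positivity) (by linarith)) h1r.le)]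
      refine ENNReal.ofReal_le_ofReal (le_of_eq ?_)
      field_simp
      ring
  have hbound (N n) (hn : N ≤ n) :
      eLpNorm (branchMartingale n - branchMartingale N) 2 (treeLaw μ)
        ≤ ENNReal.ofReal (K / (1 - r) * r ^ N) := by
    obtain ⟨j, rfl⟩ := Nat.exists_eq_add_of_le hn
    refine (hsum N j).trans (ENNReal.ofReal_le_ofReal ?_)
    have hrj : 0 ≤ r ^ j := by positivity
    rw [div_mul_eq_mul_div]
    refine div_le_div_of_nonneg_right ?_ h1r.le
    exact mul_le_of_le_one_right (by positivity) (by linarith)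
  -- Twice the geometric tail, plus 1 in the coefficient so that the inequality is strict even when
  -- K = 0.
  refine ⟨fun N => ENNReal.ofReal ((2 * (K / (1 - r)) + 1) * r ^ N), ?_, fun N n m hn hm => ?_⟩
  · rw [← ENNReal.ofReal_tsum_of_nonneg (fun n => by positivity)
      ((summable_geometric_of_lt_one hr0.le hr1).mul_left _)]
    exact ENNReal.ofReal_ne_top
  · have e : branchMartingale n - branchMartingale m
        = (branchMartingale n - branchMartingale N) - (branchMartingale m - branchMartingale N) := by
      abel
    rw [e]
    refine (eLpNorm_sub_le ((hmm _).sub (hmm _)).aestronglyMeasurable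
      ((hmm _).sub (hmm _)).aestronglyMeasurable one_le_two).trans_lt
      ((add_le_add (hbound N n hn) (hbound N m hm)).trans_lt ?_)
    rw [← ENNReal.ofReal_add (by positivity) (by positivity)]
    have : 0 < r ^ N := by positivity
    exact (ENNReal.ofReal_lt_ofReal_iff (by positivity)).2 (by linarith)

theorem measurable_martingaleLimit : Measurable martingaleLimit := by
  have h : martingaleLimit = fun t => limUnder atTop fun n => branchMartingale n t := by
    ext t
    rw [martingaleLimit]
    congr 1
    ext n
    exact additiveMartingale_eq t n
  rw [h]
  exact (StronglyMeasurable.limUnder fun n =>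
    (measurable_branchMartingale n).stronglyMeasurable).measurable

/-- Summable Cauchy bounds give almost sure and L² convergence together, so the pointwise limit
`martingaleLimit` is also the L² limit. The increasing second moments are then bounded by that of
the limit. -/
theorem memLp_martingaleLimit_and_le
    (hmass : ∫⁻ a, ENNReal.ofReal (∑ i ∈ Finset.range a.1, a.entry i) ∂μ = 1)
    (hint : ∫⁻ a, ENNReal.ofReal ((∑ i ∈ Finset.range a.1, a.entry i) ^ 2) ∂μ < ⊤)
    (h2 : weightMoment μ 2 < 1) : MemLp martingaleLimit 2 (treeLaw μ) ∧
      ∀ n, ∫ t, branchMartingale n t ^ 2 ∂(treeLaw μ) ≤ ∫ t, martingaleLimit t ^ 2 ∂(treeLaw μ) := by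
  obtain ⟨B, hB, hcau⟩ := exists_eLpNorm_branchMartingale_sub_lt hmass hint h2
  have hL := memLp_branchMartingale hint
  have hae : ∀ᵐ t ∂(treeLaw μ),
      Tendsto (fun n => branchMartingale n t) atTop (𝓝 (martingaleLimit t)) := by
    filter_upwards [Lp.ae_tendsto_of_cauchy_eLpNorm (fun n => (hL n).1) one_le_two hB hcau]
      with t ht
    have h := tendsto_nhds_limUnder ht
    have e : additiveMartingale t = fun n => branchMartingale n t :=
      funext fun n => additiveMartingale_eq t n
    rwa [martingaleLimit, e]
  have hlim := Lp.cauchy_tendsto_of_tendsto (fun n => (hL n).1) martingaleLimit hB hcau hae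
  have hM : MemLp martingaleLimit 2 (treeLaw μ) := Lp.memLp_of_cauchy_tendsto one_le_two hL _
    measurable_martingaleLimit.aestronglyMeasurable hlim
  refine ⟨hM, fun n => ?_⟩
  have hle : eLpNorm (branchMartingale n) 2 (treeLaw μ)
      ≤ 0 + eLpNorm martingaleLimit 2 (treeLaw μ) := by
    refine ge_of_tendsto (hlim.add_const _) ?_
    filter_upwards [eventually_ge_atTop n] with m hm
    have h1 : eLpNorm (branchMartingale n) 2 (treeLaw μ)
        ≤ eLpNorm (branchMartingale m) 2 (treeLaw μ) := by
      rw [eLpNorm_two_eq_ofReal_sqrt (hL n), eLpNorm_two_eq_ofReal_sqrt (hL m)]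
      exact ENNReal.ofReal_le_ofReal
        (Real.sqrt_le_sqrt (integral_sq_branchMartingale_mono hmass hint hm))
    refine h1.trans ?_
    conv_lhs => rw [← sub_add_cancel (branchMartingale m) martingaleLimit]
    exact eLpNorm_add_le ((hL m).1.sub hM.1) hM.1 one_le_two
  rw [zero_add, eLpNorm_two_eq_ofReal_sqrt (hL n), eLpNorm_two_eq_ofReal_sqrt hM,
    ENNReal.ofReal_le_ofReal_iff (Real.sqrt_nonneg _)] at hle
  exact (Real.sqrt_le_sqrt_iff (integral_nonneg fun _ => sq_nonneg _)).1 hle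

theorem memLp_inSeries_levelConductance (n : ℕ) :
    MemLp (fun t => inSeries (levelConductance n t)) 2 (treeLaw μ) := by
  refine MemLp.of_bound (measurable_inSeries_levelConductance n).aestronglyMeasurable 1
    (ae_of_all _ fun t => ?_)
  rw [Real.norm_of_nonneg (inSeries_nonneg (levelConductance_nonneg n t))]
  exact inSeries_le_one (levelConductance_nonneg n t)

theorem memLp_levelConductance
    (hint : ∫⁻ a, ENNReal.ofReal ((∑ i ∈ Finset.range a.1, a.entry i) ^ 2) ∂μ < ⊤) (n : ℕ) :
    MemLp (levelConductance n) 2 (treeLaw μ) := by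
  cases n with
  | zero => exact memLp_branchMartingale hint 1
  | succ n =>
    exact memLp_branchSum hint (measurable_inSeries_levelConductance n)
      (memLp_inSeries_levelConductance n)

/-- The normalized conductance has a smaller second moment than the additive martingale. -/
theorem integral_sq_levelConductance_le
    (hmass : ∫⁻ a, ENNReal.ofReal (∑ i ∈ Finset.range a.1, a.entry i) ∂μ = 1)
    (hint : ∫⁻ a, ENNReal.ofReal ((∑ i ∈ Finset.range a.1, a.entry i) ^ 2) ∂μ < ⊤) (n : ℕ) :
    ∫ t, (levelConductance n t / expectedConductance μ n) ^ 2 ∂(treeLaw μ)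
      ≤ ∫ t, branchMartingale (n + 1) t ^ 2 ∂(treeLaw μ) := by
  induction n with
  | zero => simp only [expectedConductance_zero hmass, div_one]; exact le_rfl
  | succ n ih =>
    have hi := integrable_levelConductance hmass n
    have h0 := levelConductance_nonneg n
    have hx := expectedConductance_pos hmass n
    have hx1 := expectedConductance_pos hmass (n + 1)
    have hL : MemLp (fun t => inSeries (levelConductance n t) / expectedConductance μ (n + 1)) 2
        (treeLaw μ) := by
      simpa only [div_eq_mul_inv] using (memLp_inSeries_levelConductance n).mul_const _
    have hL2 : MemLp (fun t => levelConductance n t / ∫ t, levelConductance n t ∂(treeLaw μ)) 2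
        (treeLaw μ) := by
      simpa only [div_eq_mul_inv] using (memLp_levelConductance hint n).mul_const _
    have h1 : ∫ t, inSeries (levelConductance n t) / expectedConductance μ (n + 1) ∂(treeLaw μ)
        = 1 := by rw [integral_div, ← expectedConductance_succ hmass, div_self hx1.ne']
    have hs := integral_sq_branchSum hint
      (F := fun t => inSeries (levelConductance n t) / expectedConductance μ (n + 1))
      ((measurable_inSeries_levelConductance n).div_const _) hL
    simp only [branchSum_div] at hs
    rw [levelConductance_succ, hs, h1, integral_sq_branchMartingale_succ hmass hint (n + 1),
      one_pow, mul_one]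
    -- Both second moments pass through the same affine map; what is left is the convex comparison
    -- for the square.
    refine add_le_add (mul_le_mul_of_nonneg_left (le_trans ?_ ih) ENNReal.toReal_nonneg) le_rfl
    have hs2 := hL.integrable_sq
    rw [expectedConductance_succ hmass] at hs2 ⊢
    exact integral_comp_inSeries_le hi h0 hx hasSupportSlopes_sq hs2 hL2.integrable_sq

/-- Cauchy–Schwarz gives (E C)² ≤ E[C/(1+C)] · E[C + C²]; with E C² ≤ V x² this makes 1/x grow by at
most V per step. -/
theorem inv_expectedConductance_le
    (hmass : ∫⁻ a, ENNReal.ofReal (∑ i ∈ Finset.range a.1, a.entry i) ∂μ = 1)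
    (hint : ∫⁻ a, ENNReal.ofReal ((∑ i ∈ Finset.range a.1, a.entry i) ^ 2) ∂μ < ⊤)
    {V : ℝ} (hV : ∀ n, ∫ t, branchMartingale n t ^ 2 ∂(treeLaw μ) ≤ V) (n : ℕ) :
    (expectedConductance μ n)⁻¹ ≤ ((n + 1 : ℕ) : ℝ) * V := by
  have hV1 : 1 ≤ V := by simpa [branchMartingale] using hV 0
  induction n with
  | zero => simpa [expectedConductance_zero hmass] using hV1
  | succ n ih =>
    have hx := expectedConductance_pos hmass n
    have hi := integrable_levelConductance hmass n
    have h0 := levelConductance_nonneg n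
    have hsq := (memLp_levelConductance hint n).integrable_sq
    have hx2 : ∫ t, levelConductance n t ^ 2 ∂(treeLaw μ) ≤ V * expectedConductance μ n ^ 2 := by
      have h := (integral_sq_levelConductance_le hmass hint n).trans (hV (n + 1))
      simp only [div_pow] at h
      rwa [integral_div, div_le_iff₀ (by positivity)] at h
    have hE : ∫ t, levelConductance n t ∂(treeLaw μ) = expectedConductance μ n := rfl
    set x := expectedConductance μ n
    have hd : 0 < 1 + V * x := by positivity
    -- Cauchy–Schwarz in tangent form: 2ly - l²(y + y²) ≤ f(y) holds for every l, and this l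
    -- maximizes 2lx - l²(x + Vx²).
    set l := 1 / (1 + V * x) with hl
    have hl0 : 0 ≤ l := by positivity
    have hpt (t) : 2 * l * levelConductance n t
        - l ^ 2 * (levelConductance n t + levelConductance n t ^ 2)
          ≤ inSeries (levelConductance n t) := by
      have hy := h0 t
      generalize levelConductance n t = y at hy ⊢
      have e : inSeries y - (2 * l * y - l ^ 2 * (y + y ^ 2))
          = y * (1 - l * (1 + y)) ^ 2 / (1 + y) := by
        unfold inSeries; field_simp; ring
      have : 0 ≤ y * (1 - l * (1 + y)) ^ 2 / (1 + y) := by positivity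
      linarith
    have hiy : Integrable (fun t => levelConductance n t + levelConductance n t ^ 2)
        (treeLaw μ) := hi.add hsq
    have hmono := integral_mono ((hi.const_mul (2 * l)).sub (hiy.const_mul (l ^ 2)))
      (integrable_inSeries hi h0) hpt
    simp only [Pi.sub_apply] at hmono
    rw [integral_sub (hi.const_mul (2 * l)) (hiy.const_mul (l ^ 2)), integral_const_mul,
      integral_const_mul, integral_add hi hsq, hE, ← expectedConductance_succ hmass] at hmono
    have hlx : l * x ≤ expectedConductance μ (n + 1) := by
      refine le_trans ?_ hmono
      have h3 := mul_le_mul_of_nonneg_left hx2 (sq_nonneg l)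
      have h4 : l ^ 2 * (x + V * x ^ 2) = l * x := by rw [hl]; field_simp
      linarith
    have hlx0 : 0 < l * x := by positivity
    refine (inv_anti₀ hlx0 hlx).trans ?_
    have e : (l * x)⁻¹ = x⁻¹ + V := by rw [hl]; field_simp
    rw [e]
    push_cast at ih ⊢
    linarith

end SquareIntegrable

/-! ### Transfer to an arbitrary probability space -/

theorem integral_effectiveConductance {Ω : Type*} [MeasurableSpace Ω] {P : Measure Ω}
    [IsProbabilityMeasure P] {μ : Measure WeightSeq} {A : Word → Ω → WeightSeq}
    (hmeas : ∀ x, Measurable (A x)) (hlaw : ∀ x, P.map (A x) = μ) (hindep : iIndepFun A P)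
    (n : ℕ) : ∫ ω, effectiveConductance (fun x => A x ω) (n + 1) ∂P = expectedConductance μ n := by
  simp only [effectiveConductance_succ]
  rw [expectedConductance, ← map_eq_treeLaw hmeas hlaw hindep,
    integral_map (measurable_pi_lambda _ hmeas).aemeasurable
      (measurable_levelConductance n).aestronglyMeasurable]

theorem zero_lt_liminf_of_eventually_le {u : ℕ → ℝ} {c : ℝ} (hc : 0 < c)
    (h : ∀ᶠ n in atTop, c ≤ u n) : (0 : EReal) < liminf (fun n => (u n : EReal)) atTop :=
  (EReal.coe_pos.2 hc).trans_le (le_liminf_of_le (by isBoundedDefault)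
    (h.mono fun _ hn => EReal.coe_le_coe_iff.2 hn))

end SubdiffusiveTree

theorem proposition2p4 {Ω : Type*} [MeasurableSpace Ω] (P : Measure Ω) [IsProbabilityMeasure P]
    (μ : Measure WeightSeq)
    (A : Word → Ω → WeightSeq)
    (hmeas : ∀ x, Measurable (A x))
    (hlaw : ∀ x, P.map (A x) = μ)
    (hindep : iIndepFun A P)
    (hnorm : HNorm μ)
    (hder : HDerivative μ)
    (hkappa : HKappa μ) :
    (1 < kappa μ → kappa μ < 2 →
      (0 : EReal) < liminf (fun n : ℕ =>
        (((n : ℝ) ^ (1 / ((kappa μ).toReal - 1)) *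
          ∫ ω, effectiveConductance (fun x => A x ω) n ∂P : ℝ) : EReal))
        atTop) ∧
    (kappa μ = 2 →
      (0 : EReal) < liminf (fun n : ℕ =>
        (((n : ℝ) * Real.log n *
          ∫ ω, effectiveConductance (fun x => A x ω) n ∂P : ℝ) : EReal))
        atTop) ∧
    (2 < kappa μ →
      Integrable (fun ω => martingaleLimit (fun x => A x ω) ^ 2) P ∧
      0 < ∫ ω, martingaleLimit (fun x => A x ω) ^ 2 ∂P ∧
      ((1 / ∫ ω, martingaleLimit (fun x => A x ω) ^ 2 ∂P : ℝ) : EReal) ≤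
        liminf (fun n : ℕ =>
          (((n : ℝ) *
            ∫ ω, effectiveConductance (fun x => A x ω) n ∂P : ℝ) : EReal))
          atTop) := by

  have hprob : IsProbabilityMeasure μ := by
    rw [← hlaw []]
    exact Measure.isProbabilityMeasure_map (hmeas []).aemeasurable
  have h1 : weightMoment μ 1 = 1 := psi_eq_zero_iff.1 hnorm
  have hmass : ∫⁻ a, ENNReal.ofReal (∑ i ∈ Finset.range a.1, a.entry i) ∂μ = 1 := by
    rw [← weightMoment_one, h1]
  have hanti : Antitone (expectedConductance μ) :=
    antitone_nat_of_succ_le (expectedConductance_succ_le hmass)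
  have hE (n : ℕ) (hn : 1 ≤ n) :
      ∫ ω, effectiveConductance (fun x => A x ω) n ∂P = expectedConductance μ (n - 1) := by
    obtain ⟨m, rfl⟩ := Nat.exists_eq_add_of_le' hn
    exact integral_effectiveConductance hmeas hlaw hindep m
  -- For the first two claims a shift of the index by one is harmless, and monotonicity absorbs it.
  have hEle (n : ℕ) (hn : 1 ≤ n) :
      expectedConductance μ n ≤ ∫ ω, effectiveConductance (fun x => A x ω) n ∂P := by
    rw [hE n hn]
    exact hanti (Nat.sub_le n 1)
  have hkap (hk1 : 1 < kappa μ) (hk2 : kappa μ ≤ 2) : ∃ k : ℝ, kappa μ = k ∧ 1 < k ∧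
      weightMoment μ k = 1 ∧
      ∫⁻ a, ENNReal.ofReal ((∑ i ∈ Finset.range a.1, a.entry i) ^ k) ∂μ < ⊤ := by
    obtain ⟨k, hk, hk1', hmk⟩ := exists_kappa_eq h1 hder (ne_top_of_le_ne_top (by decide) hk2)
    have hint := lt_of_le_of_lt (self_le_add_right _ _) (hkappa.1 hk1 hk2)
    rw [hk, EReal.toReal_coe] at hint
    exact ⟨k, hk, hk1', hmk, hint⟩
  refine ⟨fun hk1 hk2 => ?_, fun hk => ?_, fun hk => ?_⟩
  · obtain ⟨k, hk, hk1', hmk, hint⟩ := hkap hk1 hk2.le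
    have hk2' : k < 2 := by
      rw [hk] at hk2
      exact EReal.coe_lt_coe_iff.1 hk2
    obtain ⟨C, hC, hrec⟩ := exists_expectedConductance_sub_rpow_le h1 hder hk1' hk2' hmk hint
    obtain ⟨c, hc, hev⟩ := exists_le_rpow_mul_of_recursion (expectedConductance_pos hmass) hanti
      hC hk1' hk2' hrec
    rw [hk, EReal.toReal_coe]
    refine zero_lt_liminf_of_eventually_le hc ?_
    filter_upwards [hev, eventually_ge_atTop 1] with n hn h1n
    exact hn.trans (mul_le_mul_of_nonneg_left (hEle n h1n) (Real.rpow_nonneg n.cast_nonneg _))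
  · have h12 : (1 : EReal) < 2 := by norm_num
    obtain ⟨k, hk', hk1', hmk, hint⟩ := hkap (hk ▸ h12) hk.le
    have hk2 : k = 2 := by
      rw [hk'] at hk
      exact EReal.coe_eq_coe_iff.1 hk
    subst hk2
    simp only [Real.rpow_two] at hint
    obtain ⟨C, hC, hrec⟩ := exists_expectedConductance_sub_sq_mul_log_le h1 hder hmk hint
    obtain ⟨c, hc, hev⟩ := exists_le_mul_log_mul_of_recursion (expectedConductance_pos hmass) hanti
      hC hrec
    refine zero_lt_liminf_of_eventually_le hc ?_
    filter_upwards [hev, eventually_ge_atTop 1] with n hn h1n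
    exact hn.trans (mul_le_mul_of_nonneg_left (hEle n h1n)
      (mul_nonneg n.cast_nonneg (Real.log_natCast_nonneg n)))
  · have hint := hkappa.2 hk
    have h2 := weightMoment_two_lt_one h1 hder hk (ne_top_of_le_ne_top hint.ne (weightMoment_two_le μ))
    obtain ⟨hL, hle⟩ := memLp_martingaleLimit_and_le hmass hint h2
    have hA : AEMeasurable (fun ω x => A x ω) P := (measurable_pi_lambda _ hmeas).aemeasurable
    have hsqm : AEStronglyMeasurable (fun t => martingaleLimit t ^ 2)
        (P.map fun ω x => A x ω) := (measurable_martingaleLimit.pow_const 2).aestronglyMeasurable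
    have hV : ∫ ω, martingaleLimit (fun x => A x ω) ^ 2 ∂P
        = ∫ t, martingaleLimit t ^ 2 ∂(treeLaw μ) := by
      rw [← map_eq_treeLaw hmeas hlaw hindep, integral_map hA hsqm]
    have hi : Integrable (fun ω => martingaleLimit (fun x => A x ω) ^ 2) P := by
      have h := hL.integrable_sq
      rw [← map_eq_treeLaw hmeas hlaw hindep] at h
      exact (integrable_map_measure hsqm hA).1 h
    have hV1 : 1 ≤ ∫ t, martingaleLimit t ^ 2 ∂(treeLaw μ) := by
      simpa [branchMartingale] using hle 0
    rw [hV]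
    refine ⟨hi, by linarith, le_liminf_of_le (by isBoundedDefault) ?_⟩
    filter_upwards [eventually_ge_atTop 1] with n hn
    refine EReal.coe_le_coe_iff.2 ?_
    -- Here the index is kept exact: level n corresponds to index n - 1, and the bound on the
    -- inverse is then exactly n V.
    have hb := inv_expectedConductance_le hmass hint hle (n - 1)
    have hx := expectedConductance_pos hmass (n - 1)
    rw [Nat.sub_add_cancel hn, inv_le_iff_one_le_mul₀ hx] at hb
    rw [hE n hn, div_le_iff₀ (by linarith)]
    linarith
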